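/- Given positive integers $d_1,\dots,d_r$ there exists an integer $N=N(d_1,\dots,d_r)$ with the following property. Let $\mathbf{k}$ be any perfect field, let $n\ge 0$, and let $f_1,\dots,f_r\in\mathbf{k}[x_1,\dots,x_n]$ be homogeneous polynomials of degrees $d_1,\dots,d_r$ (for the standard grading) with collective strength at least $N$. Then $f_1,\dots,f_r$ is a regular sequence in $\mathbf{k}[x_1,\dots,x_n]$. In particular, $N$ does not depend on $\mathbf{k}$, on $n$, or on the $f_i$. Here the strength of a homogeneous polynomial $f$ is the minimal integer $s\ge -1$ for which there is a decomposition $f=\sum_{i=1}^{s+1} g_i h_i$ with all $g_i,h_i$ homogeneous of positive degree, or $\infty$ if no such decomposition exists. The collective strength of $f_1,\dots,f_r$ is the minimal strength of a homogeneous linear combination $c_1f_1+\cdots+c_rf_r$ with $c_1,\dots,c_r\in\mathbf{k}$ not all zero (and $\infty$ if $r=0$). -/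

import Mathlib

section Strength

variable {k R : Type*} [Field k] [CommRing R] [Algebra k R]

/-- `f` is a sum of `m` products `g i * h i`, where all `g i` and `h i` are homogeneous
elements of positive degree with respect to the grading `𝒜`. -/
def HasProductDecomposition (𝒜 : ℕ → Submodule k R) (f : R) (m : ℕ) : Prop :=
  ∃ g h : Fin m → R,
    (∀ i, ∃ a : ℕ, 0 < a ∧ g i ∈ 𝒜 a) ∧
    (∀ i, ∃ b : ℕ, 0 < b ∧ h i ∈ 𝒜 b) ∧
    f = ∑ i, g i * h i

/-- The strength of `f`: the minimal integer `s ≥ -1` such that `f` is a sum of `s + 1` products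
of homogeneous elements of positive degree, or `⊤` if there is no such decomposition
(the infimum of the empty set in `WithTop ℤ` is `⊤`). -/
noncomputable def strength (𝒜 : ℕ → Submodule k R) (f : R) : WithTop ℤ :=
  sInf {s : WithTop ℤ | ∃ m : ℕ, HasProductDecomposition 𝒜 f m ∧ s = (((m : ℤ) - 1 : ℤ) : WithTop ℤ)}

/-- The collective strength of a finite family `f`: the minimal strength of a homogeneous
`k`-linear combination of the `f i` whose coefficients are not all zero
(it is `⊤` for the empty family). -/
noncomputable def collectiveStrength {ι : Type*} [Fintype ι] (𝒜 : ℕ → Submodule k R)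
    (f : ι → R) : WithTop ℤ :=
  sInf {s : WithTop ℤ | ∃ c : ι → k, c ≠ 0 ∧
    SetLike.IsHomogeneousElem 𝒜 (∑ i, c i • f i) ∧ s = strength 𝒜 (∑ i, c i • f i)}

end Strength

/-!
Forms `f₁, …, f_r` of large collective strength behave in bounded degrees like variables. Call a
finite family of forms independent to the extent that no linear combination of members of one
degree is a sum of few products (`FormFamily.Indep`). Three steps lead to regularity.

*Relations of bounded degree.* A sufficiently independent family can be enlarged so that finitely
many given forms become polynomials in its members while the enlarged family is as independent as
desired, the requirement being allowed to grow with the size of the family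
(`FormFamily.exists_absorbBound`): a form that cannot be adjoined is, up to members, a sum of few
products of forms of lower degree, which are treated instead. A sufficiently independent family over
a perfect field has no relation of bounded degree among its members
(`FormFamily.exists_noRelation`). Indeed, let `P` be a relation of least degree, and take a variable
of top degree among those with nonzero partial derivative. A translation of the variables lifts to
the polynomial ring of an enlarged family without relations of lower degree, so `P` is invariant
under it, and by the chain rule so is this partial derivative. Evaluated at the members it is then a
constant, although it is a nonzero form of positive degree: members of the same degree as `P` do not
occur in `P`, as they would occur linearly (`FormFamily.pderiv_eq_zero_of_relation`). So all partial
derivatives of `P` vanish, and over a perfect field `P` is zero or a `p`-th power, against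
minimality.

*Bounded cancellation.* If `g * f_c` lies in the ideal of the preceding forms, with `g` of bounded
degree, then `g` and the coefficients are polynomials in the members of an enlarged family
containing the `f_i`. Since this family has no relations of bounded degree, the membership holds
with the `f_i` replaced by variables, where the claim is clear (`exists_boundedCancel`).

*From bounded to arbitrary degree.* Over an infinite field, modulo `c` of the forms there is a
regular sequence of linear forms over which the quotient ring is generated by a number of elements
that is bounded in terms of `c` and the degrees alone. The next form satisfies a monic equation over
these parameters, of bounded degree by the Cayley-Hamilton theorem. As it can be cancelled in
bounded degree, the constant term of the shortest such equation is a nonzero form `u` in the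
parameters (`exists_relation_of_parameters`). After a linear change of parameters `u` is monic in
one of them, for which the new form can be exchanged: it is a nonzerodivisor, and the remaining
parameters are again regular (`exists_parameters_step`). Finite fields are reduced to infinite ones
by passing to the algebraic closure (`BoundedCancel.map`, `mem_span_of_map`).
-/

open MvPolynomial

universe u

/-! ### Families of forms and extensions of high collective strength -/

/-- `x` is a sum of at most `N` products of two forms of positive degrees with sum `d`. -/
def IsSumOfProducts {k : Type u} [Field k] {σ : Type} (d N : ℕ) (x : MvPolynomial σ k) : Prop :=
  ∃ (κ : Type) (_ : Fintype κ) (a : κ → ℕ) (u v : κ → MvPolynomial σ k), Fintype.card κ ≤ N ∧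
    (∀ i, 0 < a i ∧ a i < d ∧ (u i).IsHomogeneous (a i) ∧ (v i).IsHomogeneous (d - a i)) ∧
    x = ∑ i, u i * v i

/-- A finite indexed family of forms of degrees between `1` and `D`. -/
structure FormFamily (k : Type u) [Field k] (σ : Type) (D : ℕ) where
  /-- the index type -/
  Idx : Type
  [fin : Fintype Idx]
  /-- the degrees, recorded because the zero form has no degree of its own -/
  deg : Idx → ℕ
  /-- the members of the family -/
  form : Idx → MvPolynomial σ k
  deg_pos : ∀ i, 0 < deg i
  deg_le : ∀ i, deg i ≤ D
  isHomogeneous : ∀ i, (form i).IsHomogeneous (deg i)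

attribute [instance] FormFamily.fin

namespace FormFamily

variable {k : Type u} [Field k] {σ : Type} {D : ℕ}

/-- The number of members. -/
def card (F : FormFamily k σ D) : ℕ := Fintype.card F.Idx

/-- Collective strength at least `N`: no nontrivial linear combination of members of one degree
is a sum of at most `N` products. -/
def Indep (F : FormFamily k σ D) (N : ℕ) : Prop :=
  ∀ (d : ℕ) (c : F.Idx → k), (∀ i, c i ≠ 0 → F.deg i = d) →
    IsSumOfProducts d N (∑ i, c i • F.form i) → c = 0

/-- The members of `F`, with their degrees, occur among those of `F'`. -/
def Extends (F F' : FormFamily k σ D) : Prop :=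
  ∃ e : F.Idx ↪ F'.Idx, ∀ i, F'.form (e i) = F.form i ∧ F'.deg (e i) = F.deg i

/-- The subalgebra generated by the members. -/
noncomputable def alg (F : FormFamily k σ D) : Subalgebra k (MvPolynomial σ k) :=
  Algebra.adjoin k (Set.range F.form)

theorem form_mem_alg (F : FormFamily k σ D) (i : F.Idx) : F.form i ∈ F.alg :=
  Algebra.subset_adjoin ⟨i, rfl⟩

theorem Indep.mono {F : FormFamily k σ D} {N N' : ℕ} (h : F.Indep N') (hN : N ≤ N') :
    F.Indep N := by
  rintro d c hc ⟨κ, i, a, u, v, hcard, h'⟩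
  exact h d c hc ⟨κ, i, a, u, v, hcard.trans hN, h'⟩

theorem Extends.refl (F : FormFamily k σ D) : F.Extends F :=
  ⟨Function.Embedding.refl _, fun _ => ⟨rfl, rfl⟩⟩

theorem Extends.trans {F F' F'' : FormFamily k σ D} (h : F.Extends F') (h' : F'.Extends F'') :
    F.Extends F'' := by
  obtain ⟨e, he⟩ := h
  obtain ⟨e', he'⟩ := h'
  exact ⟨e.trans e', fun i => ⟨(he' _).1.trans (he i).1, (he' _).2.trans (he i).2⟩⟩

theorem Extends.form_mem_alg {F F' : FormFamily k σ D} (h : F.Extends F') (i : F.Idx) :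
    F.form i ∈ F'.alg := by
  obtain ⟨e, he⟩ := h
  rw [← (he i).1]
  exact F'.form_mem_alg _

/-- The family with one more form adjoined. -/
def cons (F : FormFamily k σ D) (d : ℕ) (g : MvPolynomial σ k) (hd : 0 < d) (hD : d ≤ D)
    (hg : g.IsHomogeneous d) : FormFamily k σ D where
  Idx := Option F.Idx
  deg o := o.elim d F.deg
  form o := o.elim g F.form
  deg_pos o := by cases o <;> simp [hd, F.deg_pos]
  deg_le o := by cases o <;> simp [hD, F.deg_le]
  isHomogeneous o := by cases o <;> simp [hg, F.isHomogeneous]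

theorem extends_cons (F : FormFamily k σ D) (d : ℕ) (g : MvPolynomial σ k) (hd : 0 < d)
    (hD : d ≤ D) (hg : g.IsHomogeneous d) : F.Extends (F.cons d g hd hD hg) :=
  ⟨Function.Embedding.some, fun _ => ⟨rfl, rfl⟩⟩

/-- If adjoining `g` destroys collective strength `N`, then `g` is a combination of members up to a
sum of at most `N` products. -/
theorem exists_of_not_indep_cons {F : FormFamily k σ D} {d N : ℕ} {g : MvPolynomial σ k}
    {hd : 0 < d} {hD : d ≤ D} {hg : g.IsHomogeneous d} (hF : F.Indep N)
    (h : ¬ (F.cons d g hd hD hg).Indep N) :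
    ∃ c : F.Idx → k, IsSumOfProducts d N (g + ∑ i, c i • F.form i) := by
  simp only [Indep, not_forall] at h
  obtain ⟨d', c, hc, hs, hne⟩ := h
  have hsum : ∑ i, c i • (F.cons d g hd hD hg).form i =
      c none • g + ∑ i, c (some i) • F.form i := Fintype.sum_option _
  rw [hsum] at hs
  have h0 : c none ≠ 0 := by
    intro h0
    rw [h0, zero_smul, zero_add] at hs
    have := hF d' (fun i => c (some i)) (fun i hi => hc (some i) hi) hs
    apply hne
    funext o
    cases o with
    | none => exact h0
    | some i => exact congrFun this i
  obtain rfl : d = d' := hc none h0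
  obtain ⟨κ, _, a, u, v, hcard, hh, hx⟩ := hs
  refine ⟨fun i => (c none)⁻¹ * c (some i), κ, inferInstance, a, fun i => (c none)⁻¹ • u i, v,
    hcard, fun i => ⟨(hh i).1, (hh i).2.1, ?_, (hh i).2.2.2⟩, ?_⟩
  · exact (homogeneousSubmodule σ k (a i)).smul_mem _ (hh i).2.2.1
  · have := congrArg (fun y => (c none)⁻¹ • y) hx
    simpa only [smul_add, smul_smul, Finset.smul_sum, inv_mul_cancel₀ h0, one_smul,
      smul_mul_assoc] using this

/-- The families of `s` forms with collective strength `N` extend, for every choice of at most `t`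
forms of degrees in `[1, e]`, to families `F'` of collective strength `Φ (card F')` that
generate the chosen forms. -/
def AbsorbBound (Φ : ℕ → ℕ) (D e t s N : ℕ) : Prop :=
  ∀ (k : Type u) [Field k] (σ : Type) (F : FormFamily k σ D), F.card = s → F.Indep N →
    ∀ G : Finset (MvPolynomial σ k), G.card ≤ t →
      (∀ g ∈ G, ∃ d, 0 < d ∧ d ≤ e ∧ g.IsHomogeneous d) →
      ∃ F' : FormFamily k σ D, F.Extends F' ∧ F'.Indep (Φ F'.card) ∧ ∀ g ∈ G, g ∈ F'.alg

/-- The forms of top degree are treated one at a time: either the form can be adjoined to the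
family, or it is replaced by boundedly many forms of lower degree. -/
theorem exists_absorbBound_step (Φ : ℕ → ℕ) {D e : ℕ} (he : e + 1 ≤ D)
    (ih : ∀ t s, ∃ N, AbsorbBound.{u} Φ D e t s N) (a : ℕ) : ∀ t s, ∃ N, ∀ (k : Type u) [Field k]
    (σ : Type) (F : FormFamily k σ D), F.card = s → F.Indep N →
    ∀ G₁ G₀ : Finset (MvPolynomial σ k), G₁.card ≤ a → G₀.card ≤ t →
      (∀ g ∈ G₁, g.IsHomogeneous (e + 1)) →
      (∀ g ∈ G₀, ∃ d, 0 < d ∧ d ≤ e ∧ g.IsHomogeneous d) →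
      ∃ F' : FormFamily k σ D, F.Extends F' ∧ F'.Indep (Φ F'.card) ∧
        (∀ g ∈ G₁, g ∈ F'.alg) ∧ ∀ g ∈ G₀, g ∈ F'.alg := by
  classical
  induction a with
  | zero =>
    intro t s
    obtain ⟨N, hN⟩ := ih t s
    refine ⟨N, fun k _ σ F hc hF G₁ G₀ h1 h0 _ hG0 => ?_⟩
    obtain ⟨F', h, h', h''⟩ := hN k σ F hc hF G₀ h0 hG0
    have : G₁ = ∅ := by simpa using h1
    exact ⟨F', h, h', by simp [this], h''⟩
  | succ a iha =>
    intro t s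
    obtain ⟨N', hN'⟩ := iha t (s + 1)
    obtain ⟨N'', hN''⟩ := iha (t + (N' + N')) s
    refine ⟨max N' N'', fun k _ σ F hc hF G₁ G₀ h1 h0 hG1 hG0 => ?_⟩
    rcases G₁.eq_empty_or_nonempty with rfl | ⟨g, hg⟩
    · obtain ⟨F', h, h', _, h''⟩ := hN'' k σ F hc (hF.mono (le_max_right _ _)) ∅ G₀ (by simp)
        (h0.trans (by omega)) (by simp) hG0
      exact ⟨F', h, h', by simp, h''⟩
    have hcard : (G₁.erase g).card ≤ a := by
      rw [Finset.card_erase_of_mem hg]; omega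
    have hG1' : ∀ x ∈ G₁.erase g, x.IsHomogeneous (e + 1) :=
      fun x hx => hG1 x (Finset.mem_of_mem_erase hx)
    by_cases hind : (F.cons (e + 1) g (by omega) he (hG1 g hg)).Indep N'
    · obtain ⟨F', h, h', h'', h0'⟩ := hN' k σ _
        (by simp only [card] at hc ⊢; rw [← hc]; exact Fintype.card_option) hind
        (G₁.erase g) G₀ hcard h0 hG1' hG0
      refine ⟨F', (F.extends_cons _ _ _ _ _).trans h, h', fun x hx => ?_, h0'⟩
      by_cases hxg : x = g
      · rw [hxg]
        exact h.form_mem_alg none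
      · exact h'' x (Finset.mem_erase.2 ⟨hxg, hx⟩)
    · obtain ⟨c, κ, _, b, x, y, hκ, hxy, hsum⟩ :=
        exists_of_not_indep_cons (hF.mono (le_max_left _ _)) hind
      obtain ⟨F', h, h', h'', h0'⟩ := hN'' k σ F hc (hF.mono (le_max_right _ _)) (G₁.erase g)
        (G₀ ∪ (Finset.univ.image x ∪ Finset.univ.image y)) hcard
        ((Finset.card_union_le _ _).trans (add_le_add h0 ((Finset.card_union_le _ _).trans
          (add_le_add (Finset.card_image_le.trans hκ) (Finset.card_image_le.trans hκ)))))
        hG1' (by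
          intro z hz
          simp only [Finset.mem_union, Finset.mem_image, Finset.mem_univ, true_and] at hz
          rcases hz with hz | ⟨i, rfl⟩ | ⟨i, rfl⟩
          · exact hG0 z hz
          · exact ⟨b i, (hxy i).1, by have := (hxy i).2.1; omega, (hxy i).2.2.1⟩
          · exact ⟨_, by have := (hxy i).2.1; omega, by have := (hxy i).1; omega,
              (hxy i).2.2.2⟩)
      refine ⟨F', h, h', fun z hz => ?_, fun z hz => h0' z (by simp [hz])⟩
      by_cases hzg : z = g
      · rw [hzg, eq_sub_of_add_eq hsum]
        refine sub_mem (sum_mem fun i _ => mul_mem (h0' _ ?_) (h0' _ ?_))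
          (sum_mem fun i _ => Subalgebra.smul_mem _ (h.form_mem_alg i) _)
        · simp
        · simp
      · exact h'' z (Finset.mem_erase.2 ⟨hzg, hz⟩)

/-- Induction on the largest degree `e` of the chosen forms; without forms of positive degree the
family itself is sufficient. -/
theorem exists_absorbBound (Φ : ℕ → ℕ) (D e : ℕ) (he : e ≤ D) :
    ∀ t s, ∃ N, AbsorbBound.{u} Φ D e t s N := by
  classical
  induction e with
  | zero =>
    intro t s
    refine ⟨Φ s, fun k _ σ F hc hF G _ hG => ⟨F, .refl F, by rwa [hc], fun g hg => ?_⟩⟩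
    obtain ⟨d, h1, h2, _⟩ := hG g hg
    omega
  | succ e ih =>
    intro t s
    obtain ⟨N, hN⟩ := exists_absorbBound_step Φ he (ih (by omega)) t t s
    refine ⟨N, fun k _ σ F hc hF G hGc hG => ?_⟩
    obtain ⟨F', h, h', h1, h0⟩ := hN k σ F hc hF (G.filter (·.IsHomogeneous (e + 1)))
      (G.filter (¬ ·.IsHomogeneous (e + 1))) ((Finset.card_filter_le _ _).trans hGc)
      ((Finset.card_filter_le _ _).trans hGc) (fun g hg => (Finset.mem_filter.1 hg).2) (by
        intro g hg
        obtain ⟨hg, hne⟩ := Finset.mem_filter.1 hg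
        obtain ⟨d, hd, hde, hgd⟩ := hG g hg
        refine ⟨d, hd, ?_, hgd⟩
        rcases hde.lt_or_eq with h | rfl
        · omega
        · exact absurd hgd hne)
    refine ⟨F', h, h', fun g hg => ?_⟩
    by_cases hgd : g.IsHomogeneous (e + 1)
    · exact h1 g (Finset.mem_filter.2 ⟨hg, hgd⟩)
    · exact h0 g (Finset.mem_filter.2 ⟨hg, hgd⟩)

end FormFamily

/-! ### Weighted homogeneous polynomials -/

section Weighted

variable {k : Type u} [Field k] {ι : Type}

theorem aeval_mem_of_isWeightedHomogeneous {A : Type u} [CommRing A] [Algebra k A]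
    (𝒜 : ℕ → Submodule k A) [SetLike.GradedMonoid 𝒜] {w : ι → ℕ} {x : ι → A}
    (hx : ∀ i, x i ∈ 𝒜 (w i)) {P : MvPolynomial ι k} {m : ℕ} (hP : P.IsWeightedHomogeneous w m) :
    aeval x P ∈ 𝒜 m := by
  rw [aeval_def, eval₂_eq]
  refine sum_mem fun μ hμ => ?_
  rw [← Algebra.smul_def]
  refine Submodule.smul_mem _ _ ?_
  rw [← hP (mem_support_iff.1 hμ), Finsupp.weight_apply]
  exact SetLike.prod_pow_mem_graded 𝒜 _ _ _ fun i _ => hx i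

theorem isHomogeneous_aeval {σ : Type} {w : ι → ℕ} {x : ι → MvPolynomial σ k}
    (hx : ∀ i, (x i).IsHomogeneous (w i)) {P : MvPolynomial ι k} {m : ℕ}
    (hP : P.IsWeightedHomogeneous w m) : (aeval x P).IsHomogeneous m :=
  aeval_mem_of_isWeightedHomogeneous (homogeneousSubmodule σ k) hx hP

theorem homogeneousComponent_aeval {σ : Type} {w : ι → ℕ} {x : ι → MvPolynomial σ k}
    (hx : ∀ i, (x i).IsHomogeneous (w i)) (P : MvPolynomial ι k) (d : ℕ) :
    homogeneousComponent d (aeval x P) = aeval x (weightedHomogeneousComponent w d P) := by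
  classical
  induction P using MvPolynomial.induction_on' with
  | add p q hp hq => simp only [map_add, hp, hq]
  | monomial μ a =>
    have h := isWeightedHomogeneous_monomial w μ a rfl
    rw [homogeneousComponent_of_mem (isHomogeneous_aeval hx h),
      weightedHomogeneousComponent_of_mem h]
    split_ifs <;> simp

/-- A weighted homogeneous polynomial of positive degree is a combination of the variables of at
most that degree. -/
theorem exists_eq_sum_X_mul [Fintype ι] {w : ι → ℕ} {m : ℕ} (hm : 0 < m) {P : MvPolynomial ι k}
    (hP : P.IsWeightedHomogeneous w m) : ∃ Q : ι → MvPolynomial ι k, P = ∑ i, X i * Q i ∧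
      ∀ i, (Q i).IsWeightedHomogeneous w (m - w i) ∧ (m < w i → Q i = 0) := by
  classical
  induction hP using IsWeightedHomogeneous.induction_on with
  | zero => exact ⟨0, by simp, fun i => ⟨isWeightedHomogeneous_zero _ _ _, fun _ => rfl⟩⟩
  | add p q _ _ hp hq =>
    obtain ⟨P, rfl, hP⟩ := hp
    obtain ⟨Q, rfl, hQ⟩ := hq
    refine ⟨P + Q, by simp [mul_add, Finset.sum_add_distrib], fun i =>
      ⟨(hP i).1.add (hQ i).1, fun h => by simp [(hP i).2 h, (hQ i).2 h]⟩⟩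
  | monomial μ a hμ =>
    obtain ⟨i, hi⟩ : ∃ i, μ i ≠ 0 := by
      by_contra! h
      obtain rfl : μ = 0 := Finsupp.ext h
      simp at hμ
      omega
    have hw : Finsupp.weight w (μ - Finsupp.single i 1) + w i = m := by
      rw [Finsupp.weight_sub_single_add hi, hμ]
    refine ⟨Pi.single i (monomial (μ - Finsupp.single i 1) a), ?_, fun j => ?_⟩
    · rw [Finset.sum_eq_single i (fun j _ hj => by simp [hj]) (by simp), Pi.single_eq_same, X,
        monomial_mul, one_mul, add_comm, Finsupp.sub_add_single_one_cancel hi]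
    · by_cases hj : j = i
      · subst hj
        rw [Pi.single_eq_same]
        exact ⟨isWeightedHomogeneous_monomial _ _ _ (by omega), fun h => by omega⟩
      · rw [Pi.single_eq_of_ne hj]
        exact ⟨isWeightedHomogeneous_zero _ _ _, fun _ => rfl⟩

theorem pderiv_eq_zero_of_lt {w : ι → ℕ} {m : ℕ} {P : MvPolynomial ι k}
    (hP : P.IsWeightedHomogeneous w m) {i : ι} (hi : m < w i) : pderiv i P = 0 := by
  ext μ
  rw [coeff_pderiv, hP.coeff_eq_zero, zero_mul, coeff_zero]
  rw [map_add, Finsupp.weight_single]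
  simp
  omega

/-- Over a perfect field, a weighted homogeneous polynomial of positive degree whose partial
derivatives all vanish is zero or a `p`-th power. -/
theorem eq_zero_or_exists_eq_pow [PerfectField k] {w : ι → ℕ} {m : ℕ} (hm : 0 < m)
    {P : MvPolynomial ι k} (hP : P.IsWeightedHomogeneous w m) (hd : ∀ i, pderiv i P = 0) :
    P = 0 ∨ ∃ (p n : ℕ) (Y : MvPolynomial ι k), n < m ∧ Y.IsWeightedHomogeneous w n ∧
      P = Y ^ p := by
  have key : ∀ μ ∈ P.support, ∀ i, (μ i : k) = 0 := by
    intro μ hμ i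
    by_cases hi : μ i = 0
    · simp [hi]
    have := congrArg (coeff (μ - Finsupp.single i 1)) (hd i)
    rw [coeff_pderiv, Finsupp.sub_add_single_one_cancel hi, coeff_zero, mul_eq_zero] at this
    have h := this.resolve_left (mem_support_iff.1 hμ)
    have h1 : (μ - Finsupp.single i 1 : ι →₀ ℕ) i + 1 = μ i := by
      simp; omega
    rw [← h1]; exact_mod_cast h
  obtain ⟨p, hp⟩ := ExpChar.exists k
  rcases hp with _ | hprime
  · left
    by_contra hne
    obtain ⟨μ, hμ⟩ := Finset.nonempty_iff_ne_empty.2 (mt support_eq_empty.1 hne)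
    have : μ = 0 := Finsupp.ext fun i => by exact_mod_cast key μ hμ i
    have h := hP (mem_support_iff.1 hμ)
    rw [this, map_zero] at h
    omega
  · right
    rename_i hchar
    have : Fact p.Prime := ⟨hprime⟩
    have : ExpChar k p := .prime hprime
    have hdiv : ∀ μ ∈ P.support, p • (μ.mapRange (· / p) (Nat.zero_div p)) = μ := by
      intro μ hμ
      ext i
      simpa using Nat.mul_div_cancel' ((CharP.cast_eq_zero_iff k p _).1 (key μ hμ i))
    have hY : P = (∑ μ ∈ P.support, monomial (μ.mapRange (· / p) (Nat.zero_div p))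
        ((frobeniusEquiv k p).symm (coeff μ P))) ^ p := by
      rw [sum_pow_char]
      conv_lhs => rw [P.as_sum]
      refine Finset.sum_congr rfl fun μ hμ => ?_
      rw [monomial_pow, hdiv μ hμ, frobeniusEquiv_symm_pow_p]
    obtain ⟨n, hn⟩ : ∃ n, P ≠ 0 → p * n = m := by
      by_cases hne : P = 0
      · exact ⟨0, fun h => absurd hne h⟩
      obtain ⟨μ, hμ⟩ := Finset.nonempty_iff_ne_empty.2 (mt support_eq_empty.1 hne)
      refine ⟨Finsupp.weight w (μ.mapRange (· / p) (Nat.zero_div p)), fun _ => ?_⟩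
      rw [← hP (mem_support_iff.1 hμ), ← smul_eq_mul, ← map_nsmul, hdiv μ hμ]
    by_cases hne : P = 0
    · exact ⟨1, 0, 0, hm, isWeightedHomogeneous_zero _ _ _, by simp [hne]⟩
    refine ⟨p, n, _, ?_, ?_, hY⟩
    · have := hn hne
      have := hprime.two_le
      nlinarith
    · refine IsWeightedHomogeneous.sum _ _ _ fun μ hμ => isWeightedHomogeneous_monomial _ _ _ ?_
      have h : p * Finsupp.weight w (μ.mapRange (· / p) (Nat.zero_div p)) = m := by
        rw [← hP (mem_support_iff.1 hμ), ← smul_eq_mul, ← map_nsmul, hdiv μ hμ]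
      exact Nat.eq_of_mul_eq_mul_left hprime.pos (h.trans (hn hne).symm)

end Weighted

/-! ### Translations along a coordinate -/

section Translation

variable {k : Type u} [Field k] {ι : Type}

/-- The elements of degree `m` of `k[X_i][t]`, where `X i` has degree `w i` and `t` has
degree one. -/
def polyGraded (k : Type u) [Field k] {ι : Type} (w : ι → ℕ) (m : ℕ) :
    Submodule k (Polynomial (MvPolynomial ι k)) where
  carrier := {Q | ∀ l μ, coeff μ (Q.coeff l) ≠ 0 → Finsupp.weight w μ + l = m}
  add_mem' := by
    intro P Q hP hQ l μ h
    rw [Polynomial.coeff_add, coeff_add] at h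
    by_cases h' : coeff μ (P.coeff l) = 0
    · exact hQ l μ (by simpa [h'] using h)
    · exact hP l μ h'
  zero_mem' := by
    intro l μ h
    simp at h
  smul_mem' := by
    intro c P hP l μ h
    rw [Polynomial.coeff_smul, coeff_smul] at h
    exact hP l μ (right_ne_zero_of_smul h)

instance polyGraded.gradedMonoid (w : ι → ℕ) : SetLike.GradedMonoid (polyGraded k w) where
  one_mem := by
    classical
    intro l μ h
    rw [Polynomial.coeff_one] at h
    split_ifs at h with hl
    · rw [coeff_one] at h
      split_ifs at h with hμ
      · simp [hl, ← hμ]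
      · simp at h
    · simp at h
  mul_mem := by
    classical
    intro m n P Q hP hQ l μ h
    rw [Polynomial.coeff_mul, coeff_sum] at h
    obtain ⟨⟨a, b⟩, hab, h⟩ := Finset.exists_ne_zero_of_sum_ne_zero h
    rw [coeff_mul] at h
    obtain ⟨⟨μ₁, μ₂⟩, hμ, h⟩ := Finset.exists_ne_zero_of_sum_ne_zero h
    have h1 := hP a μ₁ (left_ne_zero_of_mul h)
    have h2 := hQ b μ₂ (right_ne_zero_of_mul h)
    rw [Finset.HasAntidiagonal.mem_antidiagonal] at hab hμ
    simp only at hab hμ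
    rw [← hab, ← hμ, map_add]
    omega

theorem coeff_isWeightedHomogeneous {w : ι → ℕ} {m l : ℕ} {Q : Polynomial (MvPolynomial ι k)}
    (hQ : Q ∈ polyGraded k w m) : (Q.coeff l).IsWeightedHomogeneous w (m - l) := by
  intro μ h
  have := hQ l μ h
  omega

theorem coeff_eq_zero_of_lt {w : ι → ℕ} {m l : ℕ} {Q : Polynomial (MvPolynomial ι k)}
    (hQ : Q ∈ polyGraded k w m) (hl : m < l) : Q.coeff l = 0 := by
  ext μ
  by_contra h
  have := hQ l μ h
  omega

theorem C_mul_X_pow_mem_polyGraded {w : ι → ℕ} {m l : ℕ} {a : MvPolynomial ι k}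
    (ha : a.IsWeightedHomogeneous w m) : Polynomial.C a * Polynomial.X ^ l ∈
      polyGraded k w (m + l) := by
  classical
  intro l' μ h
  rw [Polynomial.coeff_C_mul, Polynomial.coeff_X_pow] at h
  split_ifs at h with hl
  · rw [mul_one] at h
    rw [ha h, hl]
  · simp at h

theorem C_mem_polyGraded {w : ι → ℕ} {m : ℕ} {a : MvPolynomial ι k}
    (ha : a.IsWeightedHomogeneous w m) : Polynomial.C a ∈ polyGraded k w m := by
  simpa using C_mul_X_pow_mem_polyGraded (l := 0) ha

open Classical in
/-- The substitution `X j ↦ X j + t`, with the other variables fixed. -/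
noncomputable def translation (k : Type u) [Field k] {σ : Type} (j : σ) :
    MvPolynomial σ k →ₐ[k] Polynomial (MvPolynomial σ k) :=
  aeval fun i => Polynomial.C (X i) + if i = j then Polynomial.X else 0

theorem translation_mem {σ : Type} (j : σ) {x : MvPolynomial σ k} {d : ℕ}
    (hx : x.IsHomogeneous d) : translation k j x ∈ polyGraded k (1 : σ → ℕ) d := by
  refine aeval_mem_of_isWeightedHomogeneous _ (w := (1 : σ → ℕ)) (fun i => ?_) hx
  refine add_mem (C_mem_polyGraded (isHomogeneous_X k i)) ?_
  split_ifs
  · simpa using C_mul_X_pow_mem_polyGraded (l := 1) (isWeightedHomogeneous_one k (1 : σ → ℕ))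
  · exact zero_mem _

theorem coeff_zero_translation {σ : Type} (j : σ) (x : MvPolynomial σ k) :
    (translation k j x).coeff 0 = x := by
  classical
  induction x using MvPolynomial.induction_on with
  | C a =>
    rw [← algebraMap_eq, AlgHom.commutes]
    simp [Polynomial.algebraMap_apply]
  | add p q hp hq => rw [map_add, Polynomial.coeff_add, hp, hq]
  | mul_X p i h =>
    rw [map_mul, Polynomial.mul_coeff_zero, h, translation, aeval_X]
    split_ifs <;> simp

/-- A polynomial fixed by the translation along every coordinate is constant: substituting
`t = -X j` shows that it does not involve `X j`. -/
theorem eq_C_of_translation_eq {σ : Type} {x : MvPolynomial σ k}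
    (h : ∀ j, translation k j x = Polynomial.C x) : x = C (coeff 0 x) := by
  classical
  rw [← vars_eq_empty_iff_eq_C, Finset.eq_empty_iff_forall_notMem]
  intro j hj
  have h1 : bind₁ (fun i => X i + if i = j then -X j else 0) x = x := by
    have h2 := congrArg (Polynomial.eval (-X j)) (h j)
    rw [Polynomial.eval_C] at h2
    conv_rhs => rw [← h2]
    have h3 : (bind₁ fun i => X i + if i = j then -X j else 0) =
        ((Polynomial.aeval (-X j : MvPolynomial σ k)).restrictScalars k).comp
          (translation k j) := by
      ext1 i
      simp only [bind₁_X_right, AlgHom.comp_apply, translation, aeval_X]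
      split_ifs <;> simp
    rw [h3]
    simp
  rw [← h1] at hj
  obtain ⟨i, _, hi⟩ := mem_vars_bind₁ _ _ hj
  by_cases hij : i = j
  · simp [hij] at hi
  · rw [if_neg hij, add_zero, vars_X, Finset.mem_singleton] at hi
    exact hij hi.symm

/-- A derivation of `A`, applied to the coefficients of polynomials over `A`. -/
noncomputable def coeffDerivation {A : Type u} [CommRing A] [Algebra k A] (d : Derivation k A A) :
    Polynomial A →+ Polynomial A where
  toFun Q := Q.sum fun l a => Polynomial.monomial l (d a)
  map_zero' := by simp
  map_add' P Q := Polynomial.sum_add_index _ _ _ (by simp) (by simp)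

theorem coeff_coeffDerivation {A : Type u} [CommRing A] [Algebra k A] (d : Derivation k A A)
    (Q : Polynomial A) (l : ℕ) : (coeffDerivation d Q).coeff l = d (Q.coeff l) := by
  simp only [coeffDerivation, AddMonoidHom.coe_mk, ZeroHom.coe_mk, Polynomial.sum_def,
    Polynomial.finsetSum_coeff, Polynomial.coeff_monomial]
  rw [Finset.sum_ite_eq']
  split_ifs with h
  · rfl
  · rw [Polynomial.notMem_support_iff.1 h, map_zero]

theorem coeffDerivation_mul {A : Type u} [CommRing A] [Algebra k A] (d : Derivation k A A)
    (P Q : Polynomial A) :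
    coeffDerivation d (P * Q) = P * coeffDerivation d Q + Q * coeffDerivation d P := by
  ext l
  rw [mul_comm Q]
  simp only [coeff_coeffDerivation, Polynomial.coeff_add, Polynomial.coeff_mul, map_sum,
    Derivation.leibniz, smul_eq_mul, Finset.sum_add_distrib]
  congr 1
  exact Finset.sum_congr rfl fun _ _ => mul_comm _ _

/-- The chain rule for a substitution with values in polynomials over `A`. -/
theorem coeffDerivation_aeval [Fintype ι] {A : Type u} [CommRing A] [Algebra k A]
    (d : Derivation k A A) (x : ι → Polynomial A) (P : MvPolynomial ι k) :
    coeffDerivation d (aeval x P) =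
      ∑ i, aeval x (pderiv i P) * coeffDerivation d (x i) := by
  classical
  have hC : ∀ a : k, coeffDerivation d (algebraMap k (Polynomial A) a) = 0 := by
    intro a
    ext l
    rw [coeff_coeffDerivation, Polynomial.algebraMap_apply, Polynomial.coeff_C]
    split_ifs <;> simp
  induction P using MvPolynomial.induction_on with
  | C a => simpa [Polynomial.algebraMap_apply] using hC a
  | add p q hp hq => simp only [map_add, hp, hq, add_mul, Finset.sum_add_distrib]
  | mul_X p j h =>
    simp only [map_mul, aeval_X, coeffDerivation_mul, h, Derivation.leibniz, smul_eq_mul, map_add,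
      add_mul, Finset.sum_add_distrib, Finset.mul_sum, mul_assoc]
    congr 1
    rw [Finset.sum_eq_single j]
    · simp
    · intro i _ hi
      rw [pderiv_X_of_ne hi.symm]
      simp
    · simp

end Translation

/-! ### Algebraic independence in bounded degree -/

namespace FormFamily

variable {k : Type u} [Field k] {σ : Type} {D : ℕ}

/-- The members of `F` satisfy no nontrivial weighted homogeneous relation of degree `m`. -/
def NoRelation (F : FormFamily k σ D) (m : ℕ) : Prop :=
  ∀ P : MvPolynomial F.Idx k, P.IsWeightedHomogeneous F.deg m → aeval F.form P = 0 → P = 0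

theorem exists_aeval_eq {F : FormFamily k σ D} {x : MvPolynomial σ k} (hx : x ∈ F.alg) {d : ℕ}
    (hd : x.IsHomogeneous d) :
    ∃ P : MvPolynomial F.Idx k, P.IsWeightedHomogeneous F.deg d ∧ aeval F.form P = x := by
  rw [alg, Algebra.adjoin_range_eq_range_aeval] at hx
  obtain ⟨P, rfl⟩ := hx
  refine ⟨_, weightedHomogeneousComponent_isWeightedHomogeneous d P, ?_⟩
  rw [← homogeneousComponent_aeval F.isHomogeneous]
  exact homogeneousComponent_eq_self hd

theorem eq_C_of_isWeightedHomogeneous_zero {F : FormFamily k σ D} {P : MvPolynomial F.Idx k}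
    (hP : P.IsWeightedHomogeneous F.deg 0) : P = C (coeff 0 P) := by
  rw [← totalDegree_eq_zero_iff_eq_C, totalDegree_eq_zero_iff]
  intro μ hμ a
  by_contra ha
  have h1 := hP (mem_support_iff.1 hμ)
  have h2 := Finsupp.weight_sub_single_add (w := F.deg) ha
  have := F.deg_pos a
  omega

/-- In a relation of degree `m`, the members of degree `m` would occur linearly and the rest would
be a combination of products, so members of degree `m` do not occur. -/
theorem pderiv_eq_zero_of_relation {F : FormFamily k σ D} (hF : F.Indep F.card) {m : ℕ}
    (hm : 0 < m) {P : MvPolynomial F.Idx k} (hP : P.IsWeightedHomogeneous F.deg m)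
    (h0 : aeval F.form P = 0) (i : F.Idx) (hi : m ≤ F.deg i) : pderiv i P = 0 := by
  classical
  obtain ⟨Q, rfl, hQ⟩ := exists_eq_sum_X_mul hm hP
  have hconst : ∀ j, F.deg j = m → Q j = C (coeff 0 (Q j)) := by
    intro j hj
    have := (hQ j).1
    rw [hj, Nat.sub_self] at this
    exact eq_C_of_isWeightedHomogeneous_zero this
  have hzero : (fun j => if F.deg j = m then coeff 0 (Q j) else 0) = (0 : F.Idx → k) := by
    refine hF m _ (fun j hj => by simpa using fun h => hj (if_neg h)) ⟨{j // F.deg j < m},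
      inferInstance, fun j => F.deg j, fun j => -F.form j, fun j => aeval F.form (Q j),
      Fintype.card_subtype_le _, fun j => ⟨F.deg_pos _, j.2, (F.isHomogeneous _).neg,
        isHomogeneous_aeval F.isHomogeneous (hQ _).1⟩, ?_⟩
    rw [map_sum] at h0
    refine Eq.trans ?_ (Finset.sum_subtype (Finset.univ.filter fun j => F.deg j < m) (by simp)
      fun j => -F.form j * aeval F.form (Q j))
    rw [Finset.sum_filter, ← sub_eq_zero, ← Finset.sum_sub_distrib]
    refine (Finset.sum_congr rfl fun j _ => ?_).trans h0
    rw [map_mul, aeval_X]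
    rcases lt_trichotomy (F.deg j) m with h | h | h
    · simp [h, h.ne]
    · rw [hconst j h]
      simp [h, smul_eq_C_mul, mul_comm]
    · simp [(hQ j).2 h, h.not_gt]
  have hQ0 : ∀ j, m ≤ F.deg j → Q j = 0 := by
    intro j hj
    rcases hj.lt_or_eq with h | h
    · exact (hQ j).2 h
    · have := congrFun hzero j
      simp only [h, if_true, Pi.zero_apply] at this
      rw [hconst j h.symm, this, map_zero]
  rw [map_sum]
  refine Finset.sum_eq_zero fun j _ => ?_
  by_cases hj : m ≤ F.deg j
  · simp [hQ0 j hj]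
  · have hij : j ≠ i := by rintro rfl; exact hj hi
    have := F.deg_pos j
    rw [Derivation.leibniz, pderiv_X_of_ne hij,
      pderiv_eq_zero_of_lt (hQ j).1 (show m - F.deg j < F.deg i by omega)]
    simp

/-- A translation lifts to a homomorphism between the polynomial rings on the members, as soon as
its effect on the members can be expressed in an extended family. The lift adds to
each variable a polynomial in variables of lower degree. -/
theorem exists_lift_translation {F F' : FormFamily k σ D} {e : F.Idx ↪ F'.Idx}
    (he : ∀ i, F'.form (e i) = F.form i ∧ F'.deg (e i) = F.deg i) (j : σ)
    (hcoeff : ∀ i l, 1 ≤ l → (translation k j (F.form i)).coeff l ∈ F'.alg) :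
    ∃ x : F.Idx → Polynomial (MvPolynomial F'.Idx k),
      (∀ i, x i ∈ polyGraded k F'.deg (F.deg i)) ∧
      (∀ i, (x i).coeff 0 = X (e i)) ∧
      ∀ i, (x i).map (aeval F'.form : MvPolynomial F'.Idx k →ₐ[k] _).toRingHom =
        translation k j (F.form i) := by
  classical
  have htr : ∀ i, translation k j (F.form i) ∈ polyGraded k (1 : σ → ℕ) (F.deg i) :=
    fun i => translation_mem j (F.isHomogeneous i)
  have hG : ∀ i l, ∃ P : MvPolynomial F'.Idx k,
      P.IsWeightedHomogeneous F'.deg (F.deg i - l) ∧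
      (1 ≤ l → aeval F'.form P = (translation k j (F.form i)).coeff l) := by
    intro i l
    by_cases hl : 1 ≤ l
    · obtain ⟨P, hP, h⟩ := exists_aeval_eq (hcoeff i l hl)
        (coeff_isWeightedHomogeneous (htr i) (l := l))
      exact ⟨P, hP, fun _ => h⟩
    · exact ⟨0, isWeightedHomogeneous_zero _ _ _, fun h => absurd h hl⟩
  choose G hG hG' using hG
  refine ⟨fun i => Polynomial.C (X (e i)) +
    ∑ l ∈ Finset.Icc 1 (F.deg i), Polynomial.C (G i l) * Polynomial.X ^ l, fun i => ?_,
    fun i => ?_, fun i => ?_⟩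
  · refine add_mem (C_mem_polyGraded ?_) (sum_mem fun l hl => ?_)
    · rw [← (he i).2]
      exact isWeightedHomogeneous_X _ _ _
    · have := C_mul_X_pow_mem_polyGraded (l := l) (hG i l)
      rwa [Nat.sub_add_cancel (Finset.mem_Icc.1 hl).2] at this
  · simp only [Polynomial.coeff_add, Polynomial.coeff_C_zero, Polynomial.finsetSum_coeff,
      Polynomial.coeff_C_mul, Polynomial.coeff_X_pow]
    rw [Finset.sum_eq_zero, add_zero]
    intro l hl
    have := (Finset.mem_Icc.1 hl).1
    rw [if_neg (by omega), mul_zero]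
  · ext1 l
    simp only [Polynomial.coeff_map, Polynomial.coeff_add, Polynomial.finsetSum_coeff,
      Polynomial.coeff_C_mul, Polynomial.coeff_X_pow, mul_ite, mul_one, mul_zero,
      Finset.sum_ite_eq, Finset.mem_Icc]
    rcases Nat.eq_zero_or_pos l with rfl | hl
    · rw [coeff_zero_translation]
      simp [(he i).1]
    · rw [Polynomial.coeff_C_of_ne_zero hl.ne', zero_add]
      split_ifs with h
      · exact hG' i l hl
      · rw [coeff_eq_zero_of_lt (htr i) (by omega), map_zero]

/-- The inductive step for algebraic independence. A partial derivative of top degree of a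
relation of least degree would be a nonconstant form that is fixed by all translations. Hence
all partial derivatives vanish, and the relation is a `p`-th power of one of lower degree. -/
theorem noRelation_of_extends [PerfectField k] {F : FormFamily k σ D} (hF : F.Indep F.card)
    {m : ℕ} (hlow : ∀ n < m, F.NoRelation n)
    (hext : ∀ j : σ, ∃ F' : FormFamily k σ D, F.Extends F' ∧ (∀ n < m, F'.NoRelation n) ∧
      ∀ i l, 1 ≤ l → (translation k j (F.form i)).coeff l ∈ F'.alg) :
    F.NoRelation m := by
  classical
  intro P hP h0
  rcases Nat.eq_zero_or_pos m with rfl | hm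
  · rw [eq_C_of_isWeightedHomogeneous_zero hP] at h0 ⊢
    simpa using h0
  have hpd : ∀ i, pderiv i P = 0 := by
    by_contra! hne
    obtain ⟨i₁, hi₁⟩ := hne
    -- a variable of top degree among those with nonzero partial derivative
    obtain ⟨i, hi, hmax⟩ := (Finset.univ.filter fun i => pderiv i P ≠ 0).exists_max_image F.deg
      ⟨i₁, by simpa using hi₁⟩
    simp only [Finset.mem_filter, Finset.mem_univ, true_and] at hi hmax
    have him : F.deg i < m := by
      by_contra h
      exact hi (pderiv_eq_zero_of_relation hF hm hP h0 i (by omega))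
    have hhom : (pderiv i P).IsWeightedHomogeneous F.deg (m - F.deg i) :=
      hP.pderiv (by omega)
    have hmi : m - F.deg i < m := by have := F.deg_pos i; omega
    have hval : aeval F.form (pderiv i P) ≠ 0 := fun h => hi (hlow _ hmi _ hhom h)
    obtain ⟨j, hj⟩ : ∃ j, translation k j (aeval F.form (pderiv i P)) ≠
        Polynomial.C (aeval F.form (pderiv i P)) := by
      by_contra! h
      have hC := eq_C_of_translation_eq h
      have h1 := isHomogeneous_aeval F.isHomogeneous hhom
      rw [hC] at h1 hval
      have h2 := (isHomogeneous_C σ (coeff 0 (aeval F.form (pderiv i P)))).inj_right h1 hval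
      omega
    obtain ⟨F', ⟨e, he⟩, hno, hcoeff⟩ := hext j
    obtain ⟨x, hxg, hx0, hxt⟩ := exists_lift_translation he j hcoeff
    have hcomm : ∀ R : MvPolynomial F.Idx k, (aeval x R).map
        (aeval F'.form : MvPolynomial F'.Idx k →ₐ[k] _).toRingHom =
        translation k j (aeval F.form R) := by
      intro R
      have : (Polynomial.mapAlgHom (aeval F'.form : MvPolynomial F'.Idx k →ₐ[k] _)).comp
          (aeval x) = (translation k j).comp (aeval F.form) := by
        ext1 i
        simpa using hxt i
      exact DFunLike.congr_fun this R
    have hcoeff0 : ∀ R : MvPolynomial F.Idx k, (aeval x R).coeff 0 = rename e R := by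
      intro R
      induction R using MvPolynomial.induction_on with
      | C a =>
        rw [← algebraMap_eq, AlgHom.commutes, AlgHom.commutes]
        simp [Polynomial.algebraMap_apply]
      | add p q hp hq => rw [map_add, Polynomial.coeff_add, hp, hq, map_add]
      | mul_X p i h => rw [map_mul, Polynomial.mul_coeff_zero, h, aeval_X, hx0, map_mul, rename_X]
    have hgr : aeval x P ∈ polyGraded k F'.deg m :=
      aeval_mem_of_isWeightedHomogeneous _ hxg hP
    -- the higher coefficients are relations of lower degree
    have hPC : aeval x P = Polynomial.C (rename e P) := by
      ext1 l
      rcases Nat.eq_zero_or_pos l with rfl | hl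
      · rw [hcoeff0, Polynomial.coeff_C_zero]
      · rw [Polynomial.coeff_C_of_ne_zero hl.ne']
        by_cases hlm : m < l
        · exact coeff_eq_zero_of_lt hgr hlm
        · refine hno (m - l) (by omega) _ (coeff_isWeightedHomogeneous hgr) ?_
          have := congrArg (fun q => Polynomial.coeff q l) (hcomm P)
          rwa [h0, map_zero, Polynomial.coeff_map, Polynomial.coeff_zero] at this
    have hchain := coeffDerivation_aeval (pderiv (e i) : Derivation k (MvPolynomial F'.Idx k) _) x P
    rw [hPC, Finset.sum_eq_single i] at hchain
    · have h1 : coeffDerivation (pderiv (e i) : Derivation k (MvPolynomial F'.Idx k) _) (x i)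
          = 1 := by
        ext1 l
        rw [coeff_coeffDerivation, Polynomial.coeff_one]
        split_ifs with hl
        · rw [hl, hx0, pderiv_X_self]
        · refine pderiv_eq_zero_of_lt (coeff_isWeightedHomogeneous (hxg i)) ?_
          have := F.deg_pos i
          rw [(he i).2]
          omega
      have h2 : coeffDerivation (pderiv (e i) : Derivation k (MvPolynomial F'.Idx k) _)
          (Polynomial.C (rename e P)) = Polynomial.C (rename e (pderiv i P)) := by
        ext1 l
        rw [coeff_coeffDerivation, Polynomial.coeff_C, Polynomial.coeff_C]
        split_ifs
        · exact pderiv_rename e.injective i P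
        · simp
      rw [h1, h2, mul_one] at hchain
      apply hj
      rw [← hcomm, ← hchain, Polynomial.map_C]
      congr 1
      simp only [AlgHom.toRingHom_eq_coe, RingHom.coe_coe, aeval_rename]
      congr 2
      funext i
      exact (he i).1
    · intro i' _ hii'
      by_cases hi' : pderiv i' P = 0
      · simp [hi']
      have hle := hmax i' hi'
      have : coeffDerivation (pderiv (e i) : Derivation k (MvPolynomial F'.Idx k) _) (x i')
          = 0 := by
        ext1 l
        rw [coeff_coeffDerivation, Polynomial.coeff_zero]
        rcases Nat.eq_zero_or_pos l with rfl | hl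
        · rw [hx0, pderiv_X_of_ne (e.injective.ne hii')]
        · refine pderiv_eq_zero_of_lt (coeff_isWeightedHomogeneous (hxg i')) ?_
          have := F.deg_pos i'
          rw [(he i).2]
          omega
      rw [this, mul_zero]
    · simp
  rcases eq_zero_or_exists_eq_pow hm hP hpd with h | ⟨p, n, Y, hn, hY, rfl⟩
  · exact h
  · rw [map_pow] at h0
    have hp : p ≠ 0 := by
      rintro rfl
      simp at h0
    rw [hlow n hn Y hY (pow_eq_zero_iff hp |>.1 h0), zero_pow hp]

/-- A family of large collective strength over a perfect field satisfies no relation of small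
degree. -/
theorem exists_noRelation (D m : ℕ) : ∀ s, ∃ N, ∀ (k : Type u) [Field k] [PerfectField k]
    (σ : Type) (F : FormFamily k σ D), F.card = s → F.Indep N → ∀ n < m, F.NoRelation n := by
  classical
  induction m with
  | zero => exact fun s => ⟨0, fun _ _ _ _ _ _ _ n hn => absurd hn (Nat.not_lt_zero n)⟩
  | succ m ih =>
    intro s
    choose Φ hΦ using ih
    obtain ⟨N, hN⟩ := exists_absorbBound.{u} Φ D D le_rfl (s * D) s
    refine ⟨max N (max s (Φ s)), fun k _ _ σ F hs hF => ?_⟩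
    have hlow : ∀ n < m, F.NoRelation n := hΦ s k σ F hs
      (hF.mono ((le_max_right _ _).trans (le_max_right _ _)))
    have hm : F.NoRelation m := by
      refine noRelation_of_extends
        (hF.mono (hs.le.trans ((le_max_left _ _).trans (le_max_right _ _)))) hlow fun j => ?_
      have htr : ∀ i, translation k j (F.form i) ∈ polyGraded k (1 : σ → ℕ) (F.deg i) :=
        fun i => translation_mem j (F.isHomogeneous i)
      -- the coefficients of positive degree; those of degree zero are constants
      obtain ⟨F', hFF', hF', hG⟩ := hN k σ F hs (hF.mono (le_max_left _ _))
        (((Finset.univ ×ˢ Finset.Icc 1 D).filter fun q : F.Idx × ℕ => q.2 < F.deg q.1).image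
          fun q => (translation k j (F.form q.1)).coeff q.2)
        (Finset.card_image_le.trans ((Finset.card_filter_le _ _).trans (by
          simp [← hs, card]))) (by
          simp only [Finset.mem_image, Finset.mem_filter, Finset.mem_product, Finset.mem_univ,
            true_and, Finset.mem_Icc]
          rintro _ ⟨⟨i, l⟩, ⟨hl, hli⟩, rfl⟩
          refine ⟨F.deg i - l, Nat.sub_pos_of_lt hli, (Nat.sub_le _ _).trans (F.deg_le i),
            coeff_isWeightedHomogeneous (htr i)⟩)
      refine ⟨F', hFF', hΦ _ k σ F' rfl hF', fun i l hl => ?_⟩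
      by_cases hli : l < F.deg i
      · refine hG _ (Finset.mem_image.2 ⟨(i, l), ?_, rfl⟩)
        have := F.deg_le i
        simp only [Finset.mem_filter, Finset.mem_product, Finset.mem_univ, true_and,
          Finset.mem_Icc]
        omega
      · have h := coeff_isWeightedHomogeneous (htr i) (l := l)
        rw [show F.deg i - l = 0 by omega] at h
        have h' : ((translation k j (F.form i)).coeff l).IsHomogeneous 0 := h
        rw [← totalDegree_zero_iff_isHomogeneous, totalDegree_eq_zero_iff_eq_C] at h'
        rw [h']
        exact Subalgebra.algebraMap_mem _ _
    intro n hn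
    rcases (Nat.lt_succ_iff.1 hn).lt_or_eq with h | rfl
    · exact hlow n h
    · exact hm

end FormFamily

/-! ### Homogeneous ideals -/

section Homogeneous

variable {k : Type u} [Field k] {σ : Type}

theorem homogeneousComponent_add_mul {f : MvPolynomial σ k} {m : ℕ} (hf : f.IsHomogeneous m)
    (a : MvPolynomial σ k) (n : ℕ) :
    homogeneousComponent (n + m) (a * f) = homogeneousComponent n a * f := by
  let _ : GradedAlgebra (homogeneousSubmodule σ k) := gradedAlgebra
  have := DirectSum.coe_decompose_mul_add_of_right_mem (homogeneousSubmodule σ k)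
    (i := n) (a := a) hf
  exact (decomposition.decompose'_apply _ _).symm.trans
    (this.trans (congrArg (· * f) (decomposition.decompose'_apply _ _)))

theorem homogeneousComponent_mul_of_lt {f : MvPolynomial σ k} {m : ℕ} (hf : f.IsHomogeneous m)
    (a : MvPolynomial σ k) {n : ℕ} (h : n < m) : homogeneousComponent n (a * f) = 0 := by
  let _ : GradedAlgebra (homogeneousSubmodule σ k) := gradedAlgebra
  have := DirectSum.coe_decompose_mul_of_right_mem_of_not_le (homogeneousSubmodule σ k)
    (a := a) hf h.not_ge
  exact (decomposition.decompose'_apply _ _).symm.trans this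

/-- An ideal containing the homogeneous components of its elements. -/
def ContainsComponents (J : Ideal (MvPolynomial σ k)) : Prop :=
  ∀ x ∈ J, ∀ n, homogeneousComponent n x ∈ J

theorem mem_of_forall_homogeneousComponent_mem {J : Ideal (MvPolynomial σ k)}
    {x : MvPolynomial σ k} (h : ∀ n, homogeneousComponent n x ∈ J) : x ∈ J := by
  rw [← sum_homogeneousComponent x]
  exact sum_mem fun n _ => h n

theorem containsComponents_bot : ContainsComponents (⊥ : Ideal (MvPolynomial σ k)) := by
  intro x hx n
  rw [(Submodule.mem_bot _).1 hx, map_zero]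
  exact zero_mem _

theorem ContainsComponents.sup_span {J : Ideal (MvPolynomial σ k)} (hJ : ContainsComponents J)
    {f : MvPolynomial σ k} {d : ℕ} (hf : f.IsHomogeneous d) :
    ContainsComponents (J ⊔ Ideal.span {f}) := by
  intro x hx n
  obtain ⟨y, hy, z, hz, rfl⟩ := Submodule.mem_sup.1 hx
  obtain ⟨a, rfl⟩ := Ideal.mem_span_singleton'.1 hz
  rw [map_add]
  refine add_mem (Ideal.mem_sup_left (hJ y hy n)) (Ideal.mem_sup_right ?_)
  by_cases h : n < d
  · rw [homogeneousComponent_mul_of_lt hf a h]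
    exact zero_mem _
  · obtain ⟨c, rfl⟩ : ∃ c, n = c + d := ⟨n - d, by omega⟩
    rw [homogeneousComponent_add_mul hf]
    exact Ideal.mul_mem_left _ _ (Ideal.mem_span_singleton_self f)

end Homogeneous

/-! ### Cancellation in bounded degree -/

/-- Multiplication by `f c` is injective in degrees at most `C` modulo the preceding forms. -/
def BoundedCancel {k : Type u} [Field k] {σ : Type} {r : ℕ} (C : ℕ)
    (f : Fin r → MvPolynomial σ k) : Prop :=
  ∀ (c : Fin r) (e : ℕ) (g : MvPolynomial σ k), e ≤ C → g.IsHomogeneous e →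
    g * f c ∈ Ideal.span (f '' Set.Iio c) → g ∈ Ideal.span (f '' Set.Iio c)

theorem mem_span_image_iff {k : Type u} [Field k] {σ : Type} {r : ℕ}
    (f : Fin r → MvPolynomial σ k) (c : Fin r) (x : MvPolynomial σ k) :
    x ∈ Ideal.span (f '' Set.Iio c) ↔
      ∃ a : Fin r → MvPolynomial σ k, (∀ i, ¬ i < c → a i = 0) ∧ x = ∑ i, a i * f i := by
  classical
  constructor
  · intro h
    rw [Set.image_eq_range, Ideal.mem_span_range_iff_exists_fun] at h
    obtain ⟨b, rfl⟩ := h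
    refine ⟨fun i => if h : i < c then b ⟨i, h⟩ else 0, fun i hi => dif_neg hi, ?_⟩
    rw [← Finset.sum_subset (Finset.subset_univ (Finset.univ.filter (· < c)))
      (by intro i _ hi; simp at hi; simp [hi.not_gt])]
    rw [Finset.sum_subtype (p := (· ∈ Set.Iio c)) _ (by simp)]
    refine Finset.sum_congr rfl fun i _ => ?_
    have hi : (i : Fin r) < c := i.2
    simp [hi]
  · rintro ⟨a, ha, rfl⟩
    refine sum_mem fun i _ => ?_
    by_cases hi : i < c
    · exact Ideal.mul_mem_left _ _ (Ideal.subset_span ⟨i, hi, rfl⟩)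
    · rw [ha i hi, zero_mul]
      exact zero_mem _

/-- The variables are a regular sequence in a polynomial ring. -/
theorem mem_span_X_image_of_mul_X_mem {k : Type u} [Field k] {ι : Type} {s : Set ι} {i : ι}
    (hi : i ∉ s) {G : MvPolynomial ι k} (h : G * X i ∈ Ideal.span (X '' s)) :
    G ∈ Ideal.span (X '' s : Set (MvPolynomial ι k)) := by
  classical
  rw [mem_ideal_span_X_image] at h ⊢
  intro μ hμ
  obtain ⟨j, hj, hne⟩ := h (μ + Finsupp.single i 1) (by
    rwa [mem_support_iff, coeff_mul_X, ← mem_support_iff])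
  refine ⟨j, hj, ?_⟩
  have : i ≠ j := by rintro rfl; exact hi hj
  simpa [Finsupp.single_eq_of_ne this.symm] using hne

/-- The family of the `f i`. -/
def FormFamily.ofForms {k : Type u} [Field k] {σ : Type} {r D : ℕ} (d : Fin r → ℕ)
    (hd : ∀ i, 0 < d i) (hD : ∀ i, d i ≤ D) (f : Fin r → MvPolynomial σ k)
    (hf : ∀ i, (f i).IsHomogeneous (d i)) : FormFamily k σ D where
  Idx := Fin r
  deg := d
  form := f
  deg_pos := hd
  deg_le := hD
  isHomogeneous := hf

/-- Forms of large collective strength over a perfect field can be cancelled in bounded degree: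
the forms occurring in a relation of bounded degree are polynomials in a family that contains the
`f i` and satisfies no relation of that degree. -/
theorem exists_boundedCancel {r : ℕ} (d : Fin r → ℕ) (hd : ∀ i, 0 < d i) (C D : ℕ)
    (hD : ∀ i, C + d i ≤ D) : ∃ N, ∀ (k : Type u) [Field k] [PerfectField k] (σ : Type)
    (f : Fin r → MvPolynomial σ k) (hf : ∀ i, (f i).IsHomogeneous (d i)),
    (FormFamily.ofForms d hd (fun i => (Nat.le_add_left _ _).trans (hD i)) f hf).Indep N →
    BoundedCancel C f := by
  classical
  choose Φ hΦ using FormFamily.exists_noRelation.{u} D (D + 1)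
  obtain ⟨N, hN⟩ := FormFamily.exists_absorbBound.{u} Φ D D le_rfl (1 + r) r
  refine ⟨N, fun k _ _ σ f hf hind c e g he hg hmem => ?_⟩
  obtain ⟨a, ha, hsum⟩ := (mem_span_image_iff f c _).1 hmem
  -- the coefficients of the relation may be taken homogeneous
  obtain ⟨b, hb, hbd, hbz, hbsum⟩ : ∃ b : Fin r → MvPolynomial σ k, (∀ i, ¬ i < c → b i = 0) ∧
      (∀ i, (b i).IsHomogeneous (e + d c - d i)) ∧ (∀ i, e + d c < d i → b i = 0) ∧
      g * f c = ∑ i, b i * f i := by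
    refine ⟨fun i => if e + d c < d i then 0 else homogeneousComponent (e + d c - d i) (a i),
      fun i hi => by simp [ha i hi], fun i => ?_, fun i hi => if_pos hi, ?_⟩
    · dsimp only
      split_ifs
      · exact isHomogeneous_zero _ _ _
      · exact homogeneousComponent_isHomogeneous _ _
    · rw [← homogeneousComponent_eq_self (hg.mul (hf c)), hsum, map_sum]
      refine Finset.sum_congr rfl fun i _ => ?_
      dsimp only
      split_ifs with h
      · rw [homogeneousComponent_mul_of_lt (hf i) _ h, zero_mul]
      · rw [← homogeneousComponent_add_mul (hf i), Nat.sub_add_cancel (not_lt.1 h)]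
  have hconst : ∀ (F' : FormFamily k σ D) (x : MvPolynomial σ k), x.IsHomogeneous 0 →
      x ∈ F'.alg := by
    intro F' x hx
    rw [← totalDegree_zero_iff_isHomogeneous, totalDegree_eq_zero_iff_eq_C] at hx
    rw [hx]
    exact Subalgebra.algebraMap_mem _ _
  obtain ⟨F', hFF', hF', hG⟩ := hN k σ (FormFamily.ofForms d hd _ f hf) (Fintype.card_fin r) hind
    (({g} ∪ Finset.univ.image b).filter fun x => ¬ x.IsHomogeneous 0)
    ((Finset.card_filter_le _ _).trans ((Finset.card_union_le _ _).trans (add_le_add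
      (Finset.card_singleton g).le (Finset.card_image_le.trans (Finset.card_fin r).le)))) (by
      intro x hx
      obtain ⟨hx, hx0⟩ := Finset.mem_filter.1 hx
      obtain ⟨m, hm, hxm⟩ : ∃ m ≤ D, x.IsHomogeneous m := by
        have := hD c
        rcases Finset.mem_union.1 hx with h | h
        · rw [Finset.mem_singleton.1 h]
          exact ⟨e, by omega, hg⟩
        · obtain ⟨i, _, rfl⟩ := Finset.mem_image.1 h
          exact ⟨_, by omega, hbd i⟩
      refine ⟨m, Nat.pos_of_ne_zero ?_, hm, hxm⟩
      rintro rfl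
      exact hx0 hxm)
  obtain ⟨ε, hεi, hε⟩ : ∃ ε : Fin r → F'.Idx, Function.Injective ε ∧
      ∀ i, F'.form (ε i) = f i ∧ F'.deg (ε i) = d i := by
    obtain ⟨ε, hε⟩ := hFF'
    exact ⟨ε, ε.injective, hε⟩
  have hmemalg : ∀ x ∈ ({g} ∪ Finset.univ.image b : Finset _), x ∈ F'.alg := by
    intro x hx
    by_cases h : x.IsHomogeneous 0
    · exact hconst F' x h
    · exact hG x (Finset.mem_filter.2 ⟨hx, h⟩)
  obtain ⟨P, hP, hPg⟩ := FormFamily.exists_aeval_eq (hmemalg g (by simp)) hg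
  have hB : ∀ i, ∃ B : MvPolynomial F'.Idx k,
      (B * X (ε i)).IsWeightedHomogeneous F'.deg (e + d c) ∧ aeval F'.form B = b i ∧
      (¬ i < c → B = 0) := by
    intro i
    by_cases hi : e + d c < d i ∨ ¬ i < c
    · have hbi : b i = 0 := hi.elim (hbz i) (hb i)
      exact ⟨0, by simpa using isWeightedHomogeneous_zero _ _ _, by simp [hbi], fun _ => rfl⟩
    · push Not at hi
      obtain ⟨B, hB, hBb⟩ := FormFamily.exists_aeval_eq (hmemalg (b i) (by simp)) (hbd i)
      refine ⟨B, ?_, hBb, fun h => absurd hi.2 h⟩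
      have := hB.mul (isWeightedHomogeneous_X k F'.deg (ε i))
      rwa [(hε i).2, Nat.sub_add_cancel hi.1] at this
  choose B hBh hBb hB0 using hB
  have hXc := hP.mul (isWeightedHomogeneous_X k F'.deg (ε c))
  rw [(hε c).2] at hXc
  have hrel := hΦ _ k σ F' rfl hF' (e + d c) (by have := hD c; omega)
    (P * X (ε c) - ∑ i, B i * X (ε i))
    (hXc.sub (IsWeightedHomogeneous.sum _ _ _ fun i _ => hBh i)) (by
      simp only [map_sub, map_mul, map_sum, aeval_X, hPg, hBb, (hε _).1]
      exact sub_eq_zero.2 hbsum)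
  have hPX : P ∈ Ideal.span (X '' (ε '' Set.Iio c) : Set (MvPolynomial F'.Idx k)) := by
    refine mem_span_X_image_of_mul_X_mem (i := ε c) ?_ ?_
    · rintro ⟨i, hi, h⟩
      exact hi.ne (hεi h)
    rw [sub_eq_zero.1 hrel]
    refine sum_mem fun i _ => ?_
    by_cases hi : i < c
    · exact Ideal.mul_mem_left _ _ (Ideal.subset_span ⟨_, ⟨i, hi, rfl⟩, rfl⟩)
    · rw [hB0 i hi, zero_mul]
      exact zero_mem _
  have := Ideal.mem_map_of_mem (aeval F'.form : MvPolynomial F'.Idx k →ₐ[k] _) hPX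
  rw [hPg, Ideal.map_span] at this
  refine Ideal.span_mono ?_ this
  rintro _ ⟨_, ⟨_, ⟨i, hi, rfl⟩, rfl⟩, rfl⟩
  exact ⟨i, hi, by rw [aeval_X, (hε i).1]⟩

/-! ### Regular sequences modulo an ideal -/

/-- Each entry of the list is a nonzerodivisor modulo `J` and the preceding entries. -/
def RegMod {R : Type u} [CommRing R] : Ideal R → List R → Prop
  | _, [] => True
  | J, a :: l => (∀ g, g * a ∈ J → g ∈ J) ∧ RegMod (J ⊔ Ideal.span {a}) l

namespace RegMod

section CommRing

variable {R : Type u} [CommRing R]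

theorem append_iff {J : Ideal R} {l l' : List R} :
    RegMod J (l ++ l') ↔ RegMod J l ∧ RegMod (J ⊔ Ideal.ofList l) l' := by
  induction l generalizing J with
  | nil => simp [RegMod]
  | cons a l ih =>
    rw [List.cons_append, RegMod, RegMod, ih, Ideal.ofList_cons, sup_assoc, and_assoc]

theorem congr {J : Ideal R} {l l' : List R} (hl : List.Forall₂ (fun a b => a - b ∈ J) l l')
    (h : RegMod J l) : RegMod J l' := by
  induction l generalizing J l' with
  | nil =>
    cases hl
    trivial
  | cons a l ih =>
    cases hl with | @cons _ b _ l' hab hl =>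
    have hsup : J ⊔ Ideal.span {a} = J ⊔ Ideal.span {b} := by
      refine le_antisymm (sup_le le_sup_left ?_) (sup_le le_sup_left ?_) <;>
        rw [Ideal.span_singleton_le_iff_mem]
      · rw [← sub_add_cancel a b]
        exact add_mem (Ideal.mem_sup_left hab)
          (Ideal.mem_sup_right (Ideal.mem_span_singleton_self b))
      · rw [← sub_sub_cancel a b]
        exact sub_mem (Ideal.mem_sup_right (Ideal.mem_span_singleton_self a))
          (Ideal.mem_sup_left hab)
    refine ⟨fun g hg => h.1 g ?_, hsup ▸ ih (hl.imp fun _ _ h => Ideal.mem_sup_left h) h.2⟩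
    have := add_mem (J.mul_mem_left g hab) hg
    rwa [mul_sub, sub_add_cancel] at this

theorem of_forall_fin {J : Ideal R} {n : ℕ} {y : Fin n → R}
    (h : ∀ c g, g * y c ∈ J ⊔ Ideal.span (y '' Set.Iio c) →
      g ∈ J ⊔ Ideal.span (y '' Set.Iio c)) : RegMod J (List.ofFn y) := by
  induction n generalizing J with
  | zero => simp [RegMod]
  | succ n ih =>
    rw [List.ofFn_succ]
    refine ⟨fun g hg => by simpa using h 0 g (by simpa using hg), ih fun c g hg => ?_⟩
    have : J ⊔ Ideal.span {y 0} ⊔ Ideal.span ((fun i : Fin n => y i.succ) '' Set.Iio c) =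
        J ⊔ Ideal.span (y '' Set.Iio c.succ) := by
      rw [sup_assoc, ← Ideal.span_union]
      congr 2
      ext z
      simp only [Set.singleton_union, Set.mem_insert_iff, Set.mem_image, Set.mem_Iio]
      constructor
      · rintro (rfl | ⟨i, hi, rfl⟩)
        · exact ⟨0, Fin.succ_pos c, rfl⟩
        · exact ⟨i.succ, Fin.succ_lt_succ_iff.2 hi, rfl⟩
      · rintro ⟨i, hi, rfl⟩
        cases i using Fin.cases with
        | zero => exact Or.inl rfl
        | succ i => exact Or.inr ⟨i, Fin.succ_lt_succ_iff.1 hi, rfl⟩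
    rw [this] at hg ⊢
    exact h c.succ g hg

end CommRing

variable {k : Type u} [Field k] {σ : Type}

/-- Two consecutive entries may be interchanged. If `g * b ∈ J`, then `g` is modulo `J` a multiple
of `a` by an element with the same property, and comparing degrees shows `g ∈ J`. -/
theorem swap {J : Ideal (MvPolynomial σ k)} (hJ : ContainsComponents J) {a b : MvPolynomial σ k}
    {l : List (MvPolynomial σ k)} {d : ℕ} (hd : 0 < d) (ha : a.IsHomogeneous d)
    (h : RegMod J (a :: b :: l)) : RegMod J (b :: a :: l) := by
  obtain ⟨h1, h2, h3⟩ := h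
  have hstep : ∀ g, g * b ∈ J → ∃ q, q * b ∈ J ∧ g - q * a ∈ J := by
    intro g hg
    obtain ⟨y, hy, z, hz, hyz⟩ := Submodule.mem_sup.1 (h2 g (Ideal.mem_sup_left hg))
    obtain ⟨q, rfl⟩ := Ideal.mem_span_singleton'.1 hz
    refine ⟨q, h1 _ ?_, by rwa [← hyz, add_sub_cancel_right]⟩
    have : q * b * a = g * b - y * b := by rw [← hyz]; ring
    rw [this]
    exact sub_mem hg (J.mul_mem_right _ hy)
  refine ⟨fun g hg => mem_of_forall_homogeneousComponent_mem fun n => ?_, fun g hg => ?_, ?_⟩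
  · induction n using Nat.strong_induction_on generalizing g with
    | _ n ih =>
      obtain ⟨q, hq, hgq⟩ := hstep g hg
      rw [← sub_add_cancel g (q * a), map_add]
      refine add_mem (hJ _ hgq n) ?_
      by_cases hn : n < d
      · rw [homogeneousComponent_mul_of_lt ha q hn]
        exact zero_mem _
      · obtain ⟨c, rfl⟩ : ∃ c, n = c + d := ⟨n - d, by omega⟩
        rw [homogeneousComponent_add_mul ha]
        exact J.mul_mem_right _ (ih c (by omega) q hq)
  · obtain ⟨y, hy, z, hz, hyz⟩ := Submodule.mem_sup.1 hg
    obtain ⟨q, rfl⟩ := Ideal.mem_span_singleton'.1 hz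
    have hq : q * b ∈ J ⊔ Ideal.span {a} := by
      rw [eq_sub_of_add_eq' hyz]
      exact sub_mem (Ideal.mem_sup_right (Ideal.mem_span_singleton'.2 ⟨g, rfl⟩))
        (Ideal.mem_sup_left hy)
    obtain ⟨y', hy', z', hz', hyz'⟩ := Submodule.mem_sup.1 (h2 q hq)
    obtain ⟨q', rfl⟩ := Ideal.mem_span_singleton'.1 hz'
    have hmem : g - q' * b ∈ J := by
      refine h1 _ ?_
      have : (g - q' * b) * a = y + y' * b := by
        rw [sub_mul, ← hyz, ← hyz']; ring
      rw [this]
      exact add_mem hy (J.mul_mem_right _ hy')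
    rw [← sub_add_cancel g (q' * b)]
    exact add_mem (Ideal.mem_sup_left hmem)
      (Ideal.mem_sup_right (Ideal.mem_span_singleton'.2 ⟨q', rfl⟩))
  · rwa [sup_right_comm]

theorem perm {J : Ideal (MvPolynomial σ k)} (hJ : ContainsComponents J)
    {l l' : List (MvPolynomial σ k)} (hl : ∀ a ∈ l, ∃ d, 0 < d ∧ a.IsHomogeneous d)
    (hp : l.Perm l') (h : RegMod J l) : RegMod J l' := by
  induction hp generalizing J with
  | nil => trivial
  | cons a _ ih =>
    obtain ⟨d, _, ha⟩ := hl a (by simp)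
    exact ⟨h.1, ih (hJ.sup_span ha) (fun b hb => hl b (by simp [hb])) h.2⟩
  | swap a b l =>
    obtain ⟨d, hd, hb⟩ := hl b (by simp)
    exact swap hJ hd hb h
  | trans h₁ _ ih₁ ih₂ =>
    exact ih₂ hJ (fun a ha => hl a (h₁.mem_iff.2 ha)) (ih₁ hJ hl h)

end RegMod

/-! ### Linear parameters modulo an ideal -/

/-- An element of a ring that is generated by `κ` as a module satisfies a monic equation of degree
at most the cardinality of `κ`, by the Cayley-Hamilton theorem. -/
theorem exists_monic_eval₂_eq_zero {B A : Type u} [CommRing B] [CommRing A] (φ : B →+* A)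
    {κ : Type} [Fintype κ] (s : κ → A) (hs : ∀ t, ∃ b : κ → B, t = ∑ i, φ (b i) * s i) (y : A) :
    ∃ p : Polynomial B, p.Monic ∧ p.natDegree ≤ Fintype.card κ ∧ p.eval₂ φ y = 0 := by
  let _ : Algebra B A := φ.toAlgebra
  have hspan : Submodule.span B (Set.range s) = ⊤ := by
    rw [eq_top_iff]
    rintro t -
    obtain ⟨b, rfl⟩ := hs t
    refine sum_mem fun i _ => ?_
    rw [← RingHom.algebraMap_toAlgebra φ, ← Algebra.smul_def]
    exact Submodule.smul_mem _ _ (Submodule.subset_span ⟨i, rfl⟩)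
  have : Module.Finite B A := ⟨⟨(Set.finite_range s).toFinset, by simpa using hspan⟩⟩
  obtain ⟨p, hp, hdeg, h0⟩ :=
    LinearMap.exists_monic_and_natDegree_eq_and_aeval_eq_zero B (Algebra.lmul B A y)
  refine ⟨p, hp, ?_, ?_⟩
  · rw [hdeg, ← hspan]
    refine (Submodule.spanFinrank_span_le_ncard_of_finite (Set.finite_range s)).trans ?_
    rw [← Set.image_univ]
    exact (Set.ncard_image_le Set.finite_univ).trans (by simp)
  · rw [Polynomial.aeval_algHom_apply] at h0
    have h1 : Polynomial.aeval y p = 0 := by simpa using DFunLike.congr_fun h0 (1 : A)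
    exact h1

section Parameters

variable {k : Type u} [Field k] {σ : Type}

/-- Modulo `J`, the polynomial ring is generated by at most `N` elements as a module over the
subring `k[x]`. -/
def GeneratedBy (J : Ideal (MvPolynomial σ k)) {m : ℕ} (x : Fin m → MvPolynomial σ k) (N : ℕ) :
    Prop :=
  ∃ (κ : Type) (_ : Fintype κ) (s : κ → MvPolynomial σ k), Fintype.card κ ≤ N ∧
    ∀ t, ∃ b : κ → MvPolynomial (Fin m) k, t - ∑ i, aeval x (b i) * s i ∈ J

theorem GeneratedBy.exists_monic {J : Ideal (MvPolynomial σ k)} {m N : ℕ}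
    {x : Fin m → MvPolynomial σ k} (h : GeneratedBy J x N) (f : MvPolynomial σ k) :
    ∃ p : Polynomial (MvPolynomial (Fin m) k), p.Monic ∧ p.natDegree ≤ N ∧
      p.eval₂ (aeval x : MvPolynomial (Fin m) k →ₐ[k] _).toRingHom f ∈ J := by
  obtain ⟨κ, _, s, hκ, hs⟩ := h
  obtain ⟨p, hp, hdeg, h0⟩ := exists_monic_eval₂_eq_zero ((Ideal.Quotient.mk J).comp
    (aeval x : MvPolynomial (Fin m) k →ₐ[k] _).toRingHom) (fun i => Ideal.Quotient.mk J (s i))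
    (fun t => by
      obtain ⟨t, rfl⟩ := Ideal.Quotient.mk_surjective t
      obtain ⟨b, hb⟩ := hs t
      refine ⟨b, ?_⟩
      rw [Ideal.Quotient.eq.2 hb, map_sum]
      exact Finset.sum_congr rfl fun i _ => map_mul _ _ _) (Ideal.Quotient.mk J f)
  refine ⟨p, hp, hdeg.trans hκ, ?_⟩
  rw [← Ideal.Quotient.eq_zero_iff_mem, Polynomial.hom_eval₂]
  exact h0

/-- The parameters satisfy a nontrivial relation of bounded degree modulo `J` and `f`: the
constant term of a monic equation for `f` of least degree, which is nonzero since `f` can be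
cancelled. -/
theorem exists_relation_of_parameters {J : Ideal (MvPolynomial σ k)} (hJ : ContainsComponents J)
    (h1 : (1 : MvPolynomial σ k) ∉ J) {m N d : ℕ} {x : Fin m → MvPolynomial σ k}
    (hx : ∀ i, (x i).IsHomogeneous 1) (hgen : GeneratedBy J x N) {f : MvPolynomial σ k}
    (hd : 0 < d) (hf : f.IsHomogeneous d)
    (hcancel : ∀ e ≤ N * d, ∀ g : MvPolynomial σ k, g.IsHomogeneous e → g * f ∈ J → g ∈ J) :
    ∃ (e : ℕ) (u : MvPolynomial (Fin m) k) (v : MvPolynomial σ k), 0 < e ∧ e ≤ N * d ∧ u ≠ 0 ∧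
      u.IsHomogeneous e ∧ aeval x u - v * f ∈ J := by
  classical
  let Rel : ℕ → Prop := fun n => ∃ b : ℕ → MvPolynomial (Fin m) k, b n = 1 ∧
    (∀ j ≤ n, (b j).IsHomogeneous ((n - j) * d)) ∧
    ∑ j ∈ Finset.range (n + 1), aeval x (b j) * f ^ j ∈ J
  have hcomp : ∀ (P : MvPolynomial (Fin m) k) (n : ℕ),
      homogeneousComponent n (aeval x P) = aeval x (homogeneousComponent n P) :=
    fun P n => homogeneousComponent_aeval (w := (1 : Fin m → ℕ)) hx P n
  obtain ⟨n₀, hn₀, hrel₀⟩ : ∃ n ≤ N, Rel n := by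
    obtain ⟨p, hp, hdeg, hmem⟩ := hgen.exists_monic f
    refine ⟨p.natDegree, hdeg, fun j => homogeneousComponent ((p.natDegree - j) * d) (p.coeff j),
      ?_, fun j _ => homogeneousComponent_isHomogeneous _ _, ?_⟩
    · simp [hp.coeff_natDegree, homogeneousComponent_zero]
    · have := hJ _ hmem (p.natDegree * d)
      rw [Polynomial.eval₂_eq_sum_range, map_sum] at this
      convert this using 1
      refine Finset.sum_congr rfl fun j hj => ?_
      have hjn : j ≤ p.natDegree := Nat.lt_succ_iff.1 (Finset.mem_range.1 hj)
      rw [← hcomp, ← homogeneousComponent_add_mul (hf.pow j)]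
      congr 2
      rw [mul_comm d j, ← add_mul, Nat.sub_add_cancel hjn]
  have hex : ∃ n, Rel n := ⟨n₀, hrel₀⟩
  obtain ⟨b, hb1, hbh, hmem⟩ := Nat.find_spec hex
  have hmin : ∀ n < Nat.find hex, ¬ Rel n := fun n hn => Nat.find_min hex hn
  have hle : Nat.find hex ≤ N := (Nat.find_min' hex hrel₀).trans hn₀
  generalize Nat.find hex = n at *
  have hn : n ≠ 0 := by
    rintro rfl
    simp [hb1] at hmem
    exact h1 hmem
  rw [Finset.sum_range_succ'] at hmem
  have hsum : ∑ j ∈ Finset.range n, aeval x (b (j + 1)) * f ^ (j + 1) =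
      (∑ j ∈ Finset.range n, aeval x (b (j + 1)) * f ^ j) * f := by
    rw [Finset.sum_mul]
    exact Finset.sum_congr rfl fun j _ => by ring
  rw [hsum, pow_zero, mul_one] at hmem
  refine ⟨n * d, b 0, -∑ j ∈ Finset.range n, aeval x (b (j + 1)) * f ^ j,
    Nat.mul_pos (Nat.pos_of_ne_zero hn) hd, Nat.mul_le_mul_right d hle, fun h0 => ?_,
    by simpa using hbh 0 (Nat.zero_le _), ?_⟩
  · obtain ⟨l, rfl⟩ := Nat.exists_eq_succ_of_ne_zero hn
    refine hmin l (Nat.lt_succ_self l) ⟨fun j => b (j + 1), hb1, fun j hj => ?_, ?_⟩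
    · simpa using hbh (j + 1) (Nat.succ_le_succ hj)
    · refine hcancel (l * d) (Nat.mul_le_mul_right d ((Nat.le_succ l).trans hle)) _ ?_ ?_
      · refine IsHomogeneous.sum _ _ _ fun j hj => ?_
        have hjl : j ≤ l := Nat.lt_succ_iff.1 (Finset.mem_range.1 hj)
        have h2 := (isHomogeneous_aeval (w := (1 : Fin m → ℕ)) hx
          (hbh (j + 1) (Nat.succ_le_succ hjl))).mul (hf.pow j)
        rwa [Nat.succ_sub_succ, mul_comm d j, ← add_mul, Nat.sub_add_cancel hjl] at h2
      · simpa [h0] using hmem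
  · rw [neg_mul, sub_neg_eq_add, add_comm]
    exact hmem

/-- A form evaluated at a multiple of a point. -/
theorem aeval_algebraMap_mul {A : Type u} [CommRing A] [Algebra k A] {ι : Type} {e : ℕ}
    {P : MvPolynomial ι k} (hP : P.IsHomogeneous e) (a : ι → k) (c : A) :
    aeval (fun i => algebraMap k A (a i) * c) P = algebraMap k A (eval a P) * c ^ e := by
  rw [aeval_def, eval₂_eq, eval_eq, map_sum, Finset.sum_mul]
  refine Finset.sum_congr rfl fun μ hμ => ?_
  have he : ∑ i ∈ μ.support, μ i = e := by
    rw [hP.degree_eq_sum_deg_support hμ]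
  simp only [mul_pow, Finset.prod_mul_distrib, Finset.prod_pow_eq_pow_sum, map_mul, map_prod,
    map_pow, he, mul_assoc]

/-- Over an infinite field, a nonzero form of positive degree takes a nonzero value at a point
with some coordinate equal to one. -/
theorem exists_eval_ne_zero [Infinite k] {m e : ℕ} (he : 0 < e) {P : MvPolynomial (Fin m) k}
    (hP : P.IsHomogeneous e) (h0 : P ≠ 0) : ∃ (a : Fin m → k) (q : Fin m), a q = 1 ∧
      eval a P ≠ 0 := by
  obtain ⟨a, ha⟩ : ∃ a, eval a P ≠ 0 := by
    by_contra! h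
    exact h0 (MvPolynomial.funext fun a => by simp [h a])
  have key : ∀ c : k, eval (fun i => a i * c) P = eval a P * c ^ e := fun c => by
    have := aeval_algebraMap_mul hP a c
    simpa [aeval_eq_eval] using this
  obtain ⟨q, hq⟩ : ∃ q, a q ≠ 0 := by
    by_contra! h
    have h2 := key 0
    have h3 : (fun i => a i * 0) = a := by funext i; simp [h i]
    rw [h3, zero_pow he.ne', mul_zero] at h2
    exact ha h2
  refine ⟨fun i => a i * (a q)⁻¹, q, mul_inv_cancel₀ hq, ?_⟩
  rw [key]
  exact mul_ne_zero ha (pow_ne_zero _ (inv_ne_zero hq))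

end Parameters

section Parameters

variable {k : Type u} [Field k] {σ : Type}

/-- Let the form `u` of degree `e` take a nonzero value at the point `a`, with `a q = 1`. In the
coordinates `x l - a l * x q` and `x q` it is monic in `x q`, so that modulo `u` the powers of
`x q` below the `e`-th generate over the remaining coordinates. -/
theorem GeneratedBy.reduce {J : Ideal (MvPolynomial σ k)} {m N e : ℕ}
    {x : Fin (m + 1) → MvPolynomial σ k} (hgen : GeneratedBy J x N)
    (he : 0 < e) {u : MvPolynomial (Fin (m + 1)) k} (hu : u.IsHomogeneous e)
    {a : Fin (m + 1) → k} {q : Fin (m + 1)} (hq : a q = 1) (ha : eval a u ≠ 0)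
    {J' : Ideal (MvPolynomial σ k)}
    (hJJ' : J ≤ J') (hmem : aeval x u ∈ J') :
    GeneratedBy J' (fun l => x (q.succAbove l) - C (a (q.succAbove l)) * x q) (N * e) := by
  classical
  obtain ⟨κ, _, s, hκ, hs⟩ := hgen
  set x' : Fin m → MvPolynomial σ k :=
    fun l => x (q.succAbove l) - C (a (q.succAbove l)) * x q with hx'
  -- `ψ` writes the old coordinates in terms of the new ones, with `x q` as polynomial variable
  let ψ : Fin (m + 1) → Polynomial (MvPolynomial (Fin m) k) :=
    q.insertNth Polynomial.X fun l =>
      Polynomial.C (X l) + Polynomial.C (C (a (q.succAbove l))) * Polynomial.X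
  let θ : Polynomial (MvPolynomial (Fin m) k) →+* MvPolynomial σ k :=
    Polynomial.eval₂RingHom (aeval x' : MvPolynomial (Fin m) k →ₐ[k] _).toRingHom (x q)
  have hθ : ∀ P : MvPolynomial (Fin (m + 1)) k, θ (aeval ψ P) = aeval x P := by
    intro P
    induction P using MvPolynomial.induction_on with
    | C c =>
      rw [← algebraMap_eq, AlgHom.commutes, AlgHom.commutes]
      simp [θ, Polynomial.algebraMap_apply]
    | add p₁ p₂ h₁ h₂ => rw [map_add, map_add, h₁, h₂, map_add]
    | mul_X p i h =>
      rw [map_mul, map_mul, h, map_mul, aeval_X, aeval_X]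
      congr 1
      cases i using q.succAboveCases with
      | x => simp [θ, ψ]
      | p l => simp [θ, ψ, hx', algebraMap_eq]
  have hψ : ∀ i, ψ i ∈ polyGraded k (1 : Fin m → ℕ) 1 := by
    have hX : (Polynomial.X : Polynomial (MvPolynomial (Fin m) k)) ∈
        polyGraded k (1 : Fin m → ℕ) 1 := by
      simpa using C_mul_X_pow_mem_polyGraded (l := 1) (isWeightedHomogeneous_one k (1 : Fin m → ℕ))
    intro i
    cases i using q.succAboveCases with
    | x => simpa [ψ] using hX
    | p l =>
      simp only [ψ, Fin.insertNth_apply_succAbove]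
      refine add_mem (C_mem_polyGraded (isHomogeneous_X k l)) ?_
      simpa using C_mul_X_pow_mem_polyGraded (l := 1)
        (isWeightedHomogeneous_C (1 : Fin m → ℕ) (a (q.succAbove l)))
  have hgr : aeval ψ u ∈ polyGraded k (1 : Fin m → ℕ) e :=
    aeval_mem_of_isWeightedHomogeneous _ (w := (1 : Fin (m + 1) → ℕ)) hψ hu
  -- the leading coefficient is computed by setting the remaining coordinates to zero
  have hlead : (aeval ψ u).coeff e = C (eval a u) := by
    have hc : ((aeval ψ u).coeff e).IsHomogeneous 0 := by
      have := coeff_isWeightedHomogeneous hgr (l := e)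
      rwa [Nat.sub_self] at this
    rw [← totalDegree_zero_iff_isHomogeneous, totalDegree_eq_zero_iff_eq_C] at hc
    rw [hc]
    congr 1
    have hcomp : (Polynomial.mapAlgHom (aeval (fun _ => 0) : MvPolynomial (Fin m) k →ₐ[k] k))
        (aeval ψ u) = aeval (fun i => algebraMap k (Polynomial k) (a i) * Polynomial.X) u := by
      rw [← AlgHom.comp_apply, comp_aeval]
      congr 2
      funext i
      cases i using q.succAboveCases with
      | x => simp [ψ, hq]
      | p l => simp [ψ]
    rw [aeval_algebraMap_mul hu] at hcomp
    have := congrArg (fun p => Polynomial.coeff p e) hcomp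
    simp only [Polynomial.coe_mapAlgHom, Polynomial.coeff_map] at this
    rw [hc] at this
    simpa [Polynomial.coeff_X_pow] using this
  set Q : Polynomial (MvPolynomial (Fin m) k) :=
    Polynomial.C (C (eval a u)⁻¹) * aeval ψ u with hQdef
  have hQlead : Q.coeff e = 1 := by
    rw [hQdef, Polynomial.coeff_C_mul, hlead, ← C_mul, inv_mul_cancel₀ ha, C_1]
  have hQdeg : Q.natDegree ≤ e := by
    refine Polynomial.natDegree_le_iff_coeff_eq_zero.2 fun l hl => ?_
    rw [hQdef, Polynomial.coeff_C_mul, coeff_eq_zero_of_lt hgr hl, mul_zero]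
  have hQ : Q.Monic := Polynomial.monic_of_natDegree_le_of_coeff_eq_one e hQdeg hQlead
  have hθQ : θ Q ∈ J' := by
    rw [hQdef, map_mul, hθ]
    exact J'.mul_mem_left _ hmem
  have hred : ∀ P : MvPolynomial (Fin (m + 1)) k,
      aeval x P - ∑ j : Fin e, aeval x' ((aeval ψ P %ₘ Q).coeff j) * x q ^ (j : ℕ) ∈ J' := by
    intro P
    have h1 : θ (aeval ψ P %ₘ Q) =
        ∑ j : Fin e, aeval x' ((aeval ψ P %ₘ Q).coeff j) * x q ^ (j : ℕ) := by
      rw [Fin.sum_univ_eq_sum_range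
        (fun j => aeval x' ((aeval ψ P %ₘ Q).coeff j) * x q ^ j) e]
      refine Polynomial.eval₂_eq_sum_range' _ ?_ _
      have hQ1 : Q ≠ 1 := fun hQ1 => by
        rw [hQ1, Polynomial.coeff_one, if_neg he.ne'] at hQlead
        exact zero_ne_one hQlead
      exact (Polynomial.natDegree_modByMonic_lt _ hQ hQ1).trans_le hQdeg
    rw [← h1, ← hθ, ← map_sub]
    have h2 : aeval ψ P - aeval ψ P %ₘ Q = Q * (aeval ψ P /ₘ Q) := by
      rw [sub_eq_iff_eq_add']
      exact (Polynomial.modByMonic_add_div _ Q).symm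
    rw [h2, map_mul]
    exact J'.mul_mem_right _ hθQ
  refine ⟨κ × Fin e, inferInstance, fun ij => s ij.1 * x q ^ (ij.2 : ℕ), ?_, fun t => ?_⟩
  · rw [Fintype.card_prod, Fintype.card_fin]
    exact Nat.mul_le_mul_right e hκ
  · obtain ⟨b, hb⟩ := hs t
    refine ⟨fun ij => (aeval ψ (b ij.1) %ₘ Q).coeff ij.2, ?_⟩
    have h3 : t - ∑ ij : κ × Fin e, aeval x' ((aeval ψ (b ij.1) %ₘ Q).coeff ij.2) *
        (s ij.1 * x q ^ (ij.2 : ℕ)) = (t - ∑ i, aeval x (b i) * s i) +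
        ∑ i, (aeval x (b i) - ∑ j : Fin e, aeval x' ((aeval ψ (b i) %ₘ Q).coeff j) *
          x q ^ (j : ℕ)) * s i := by
      simp only [Fintype.sum_prod_type, sub_mul, Finset.sum_sub_distrib, Finset.sum_mul]
      rw [sub_add_sub_cancel]
      congr 1
      refine Finset.sum_congr rfl fun i _ => Finset.sum_congr rfl fun j _ => by ring
    rw [h3]
    exact add_mem (hJJ' hb) (sum_mem fun i _ => J'.mul_mem_right _ (hred _))

/-- In the situation of `GeneratedBy.reduce`, if `u` is modulo `J` a multiple of `f` and the
parameters are a regular sequence modulo `J`, then one parameter can be exchanged for `f`, since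
`u` is a power of `x q` up to a scalar and the remaining parameters. -/
theorem RegMod.exchange {J : Ideal (MvPolynomial σ k)} (hJ : ContainsComponents J) {m e d : ℕ}
    {x : Fin (m + 1) → MvPolynomial σ k} (hx : ∀ i, (x i).IsHomogeneous 1)
    (hreg : RegMod J (List.ofFn x)) {u : MvPolynomial (Fin (m + 1)) k} (hu : u.IsHomogeneous e)
    {a : Fin (m + 1) → k} {q : Fin (m + 1)} (hq : a q = 1) (ha : eval a u ≠ 0)
    {f v : MvPolynomial σ k} (hd : 0 < d) (hf : f.IsHomogeneous d)
    (huf : aeval x u - v * f ∈ J) :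
    RegMod J (f :: List.ofFn fun l => x (q.succAbove l) - C (a (q.succAbove l)) * x q) := by
  classical
  set x' : Fin m → MvPolynomial σ k :=
    fun l => x (q.succAbove l) - C (a (q.succAbove l)) * x q with hx'
  have hx'h : ∀ l, (x' l).IsHomogeneous 1 := fun l => (hx _).sub ((hx q).C_mul _)
  have hhom : ∀ y : MvPolynomial σ k, ∀ n, 0 < n → y.IsHomogeneous n →
      ∀ z ∈ List.ofFn x' ++ [y], ∃ d, 0 < d ∧ z.IsHomogeneous d := by
    intro y n hn hy z hz
    simp only [List.mem_append, List.mem_ofFn, List.mem_singleton] at hz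
    rcases hz with ⟨l, rfl⟩ | rfl
    · exact ⟨1, one_pos, hx'h l⟩
    · exact ⟨n, hn, hy⟩
  have h1 : RegMod J (x q :: List.ofFn fun l => x (q.succAbove l)) := by
    refine RegMod.perm hJ (fun z hz => ?_) ?_ hreg
    · obtain ⟨i, rfl⟩ := List.mem_ofFn.1 hz
      exact ⟨1, one_pos, hx i⟩
    · have := Equiv.Perm.ofFn_comp_perm ((finSuccEquiv' 0).trans (finSuccEquiv' q).symm) x
      rw [List.ofFn_succ] at this
      have h0 : x q = (x ∘ (finSuccEquiv' 0).trans (finSuccEquiv' q).symm) 0 := by simp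
      have hs : (fun l => x (q.succAbove l)) =
          fun l : Fin m => (x ∘ (finSuccEquiv' 0).trans (finSuccEquiv' q).symm) l.succ := by
        funext l
        rw [Function.comp_apply, Equiv.trans_apply, ← Fin.zero_succAbove,
          finSuccEquiv'_succAbove, finSuccEquiv'_symm_some]
      rw [h0, hs]
      exact this.symm
  have h2 : RegMod J (x q :: List.ofFn x') := by
    refine ⟨h1.1, RegMod.congr ?_ h1.2⟩
    rw [List.forall₂_iff_get]
    refine ⟨by simp, fun i _ _ => ?_⟩
    simp only [List.get_eq_getElem, List.getElem_ofFn, hx', sub_sub_cancel]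
    exact Ideal.mul_mem_left _ _ (Ideal.mem_sup_right (Ideal.mem_span_singleton_self _))
  have h3 : RegMod J (List.ofFn x' ++ [x q]) := by
    refine RegMod.perm hJ (fun z hz => ?_) (List.perm_append_singleton _ _).symm h2
    exact hhom (x q) 1 one_pos (hx q) z ((List.perm_append_singleton _ _).mem_iff.2 hz)
  rw [RegMod.append_iff] at h3
  obtain ⟨h3, h4, -⟩ := h3
  set J' := J ⊔ Ideal.ofList (List.ofFn x') with hJ'
  have hpow : ∀ n g, g * x q ^ n ∈ J' → g ∈ J' := by
    intro n
    induction n with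
    | zero => intro g hg; simpa using hg
    | succ n ih =>
      intro g hg
      exact ih g (h4 _ (by rwa [pow_succ, ← mul_assoc] at hg))
  have hu' : aeval x u - C (eval a u) * x q ^ e ∈ J' := by
    have hmk : ∀ i, Ideal.Quotient.mkₐ k J' (x i) =
        algebraMap k _ (a i) * Ideal.Quotient.mkₐ k J' (x q) := by
      intro i
      cases i using q.succAboveCases with
      | x => simp [hq]
      | p l =>
        have : x' l ∈ J' := Ideal.mem_sup_right (Ideal.subset_span (by simp))
        rw [← (Ideal.Quotient.mkₐ k J').commutes, ← map_mul]
        exact Ideal.Quotient.eq.2 this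
    rw [← Ideal.Quotient.eq]
    change Ideal.Quotient.mkₐ k J' (aeval x u) = Ideal.Quotient.mkₐ k J' (C (eval a u) * x q ^ e)
    rw [← AlgHom.comp_apply, comp_aeval]
    have : (fun i => Ideal.Quotient.mkₐ k J' (x i)) =
        fun i => algebraMap k _ (a i) * Ideal.Quotient.mkₐ k J' (x q) := funext hmk
    rw [this, aeval_algebraMap_mul hu, map_mul, map_pow, ← algebraMap_eq, AlgHom.commutes]
  have h5 : RegMod J (List.ofFn x' ++ [f]) := by
    refine RegMod.append_iff.2 ⟨h3, fun g hg => hpow e g ?_, trivial⟩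
    have h6 : g * x q ^ e = C (eval a u)⁻¹ * (v * (g * f) + g * (aeval x u - v * f) -
        g * (aeval x u - C (eval a u) * x q ^ e)) := by
      have : (C (eval a u)⁻¹ * C (eval a u) : MvPolynomial σ k) = 1 := by
        rw [← C_mul, inv_mul_cancel₀ ha, C_1]
      linear_combination (-(g * x q ^ e)) * this
    rw [h6]
    exact J'.mul_mem_left _ (sub_mem (add_mem (J'.mul_mem_left _ hg)
      (J'.mul_mem_left _ (Ideal.mem_sup_left huf))) (J'.mul_mem_left _ hu'))
  exact RegMod.perm hJ (hhom f d hd hf) (List.perm_append_singleton _ _) h5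

/-- One more form, cancellable in bounded degree, is a nonzerodivisor, and the parameters can be
replaced by parameters modulo the larger ideal. -/
theorem exists_parameters_step [Infinite k] {J : Ideal (MvPolynomial σ k)}
    (hJ : ContainsComponents J) (hJ0 : ∀ y ∈ J, constantCoeff y = 0) {m N d : ℕ}
    {x : Fin m → MvPolynomial σ k} (hx : ∀ i, (x i).IsHomogeneous 1)
    (hreg : RegMod J (List.ofFn x)) (hgen : GeneratedBy J x N) {f : MvPolynomial σ k}
    (hd : 0 < d) (hf : f.IsHomogeneous d)
    (hcancel : ∀ e ≤ N * d, ∀ g : MvPolynomial σ k, g.IsHomogeneous e → g * f ∈ J → g ∈ J) :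
    ∃ (m' : ℕ) (x' : Fin m' → MvPolynomial σ k), (∀ i, (x' i).IsHomogeneous 1) ∧
      RegMod J (f :: List.ofFn x') ∧ GeneratedBy (J ⊔ Ideal.span {f}) x' (N * (N * d)) := by
  obtain ⟨e, u, v, he, heN, hu0, hu, huf⟩ := exists_relation_of_parameters hJ
    (fun h => by simpa using hJ0 1 h) hx hgen hd hf hcancel
  obtain ⟨a, q, hq, ha⟩ := exists_eval_ne_zero he hu hu0
  cases m with
  | zero => exact q.elim0
  | succ m =>
    refine ⟨m, _, fun l => (hx _).sub ((hx q).C_mul _),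
      RegMod.exchange hJ hx hreg hu hq ha hd hf huf, ?_⟩
    obtain ⟨κ, i, s, hκ, hs⟩ := hgen.reduce he hu hq ha (le_sup_left (b := Ideal.span {f})) (by
      rw [← sub_add_cancel (aeval x u) (v * f)]
      exact add_mem (Ideal.mem_sup_left huf)
        (Ideal.mem_sup_right (Ideal.mem_span_singleton'.2 ⟨v, rfl⟩)))
    exact ⟨κ, i, s, hκ.trans (Nat.mul_le_mul_left N heN), hs⟩

end Parameters

/-! ### Cancellation in all degrees over an infinite field -/

/-- The bound on the number of module generators over the linear parameters, modulo `c` forms of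
degree at most `Δ`. -/
def paramBound (Δ : ℕ) : ℕ → ℕ
  | 0 => 1
  | c + 1 => paramBound Δ c * (paramBound Δ c * Δ)

section Infinite

variable {k : Type u} [Field k]

theorem regMod_bot_X (n : ℕ) :
    RegMod (⊥ : Ideal (MvPolynomial (Fin n) k)) (List.ofFn X) := by
  refine RegMod.of_forall_fin fun c g hg => ?_
  rw [bot_sup_eq] at hg ⊢
  exact mem_span_X_image_of_mul_X_mem (by simp) hg

theorem generatedBy_bot_X (n : ℕ) :
    GeneratedBy (⊥ : Ideal (MvPolynomial (Fin n) k)) X 1 :=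
  ⟨Unit, inferInstance, fun _ => 1, by simp, fun t => ⟨fun _ => t, by simp⟩⟩

/-- As long as the forms can be cancelled in bounded degree, the first `c` of them are
nonzerodivisors modulo their predecessors, and there are linear parameters modulo these forms. -/
theorem exists_parameters [Infinite k] {n r : ℕ} {d : Fin r → ℕ} (hd : ∀ i, 0 < d i) {Δ B : ℕ}
    (hΔ : ∀ i, d i ≤ Δ) (hB : ∀ c < r, paramBound Δ c * Δ ≤ B)
    {f : Fin r → MvPolynomial (Fin n) k} (hf : ∀ i, (f i).IsHomogeneous (d i))
    (hcancel : BoundedCancel B f) (c : ℕ) (hc : c ≤ r) :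
    (∀ i : Fin r, i < c → ∀ g, g * f i ∈ Ideal.span (f '' Set.Iio i) →
      g ∈ Ideal.span (f '' Set.Iio i)) ∧
    ContainsComponents (Ideal.span (f '' {i | i < c})) ∧
    ∃ (m : ℕ) (x : Fin m → MvPolynomial (Fin n) k), (∀ i, (x i).IsHomogeneous 1) ∧
      RegMod (Ideal.span (f '' {i | i < c})) (List.ofFn x) ∧
      GeneratedBy (Ideal.span (f '' {i | i < c})) x (paramBound Δ c) := by
  induction c with
  | zero =>
    have h0 : Ideal.span (f '' {i | (i : ℕ) < 0}) = ⊥ := by simp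
    rw [h0]
    exact ⟨fun i hi => absurd hi (Nat.not_lt_zero _), containsComponents_bot, n, X,
      fun i => isHomogeneous_X k i, regMod_bot_X n, generatedBy_bot_X n⟩
  | succ c ih =>
    obtain ⟨h1, h2, m, x, hx, hreg, hgen⟩ := ih (Nat.le_of_succ_le hc)
    have hspan : Ideal.span (f '' {i | (i : ℕ) < c + 1}) =
        Ideal.span (f '' {i | (i : ℕ) < c}) ⊔ Ideal.span {f ⟨c, hc⟩} := by
      rw [← Ideal.span_union, ← Set.image_singleton, ← Set.image_union]
      congr 2
      ext i
      simp only [Set.mem_ofPred_eq, Set.mem_union, Set.mem_singleton_iff, Fin.ext_iff]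
      omega
    obtain ⟨m', x', hx', ⟨hnzd, hreg'⟩, κ, _, s, hκ, hs⟩ := exists_parameters_step h2
      (fun y hy => by
        rw [← RingHom.mem_ker]
        refine (Ideal.span_le.2 ?_ : Ideal.span (f '' {i | (i : ℕ) < c}) ≤ _) hy
        rintro _ ⟨i, _, rfl⟩
        exact (hf i).coeff_eq_zero (by simpa using (hd i).ne)) hx hreg hgen (hd ⟨c, hc⟩)
      (hf ⟨c, hc⟩) (fun e he g hg hmem => hcancel ⟨c, hc⟩ e g (he.trans
        ((Nat.mul_le_mul_left _ (hΔ _)).trans (hB c hc))) hg hmem)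
    rw [hspan]
    refine ⟨fun i hi g hg => ?_, h2.sup_span (hf _), m', x', hx', hreg', κ, _, s, hκ.trans
      (Nat.mul_le_mul_left _ (Nat.mul_le_mul_left _ (hΔ _))), hs⟩
    rcases Nat.lt_succ_iff_lt_or_eq.1 hi with hi | hi
    · exact h1 i hi g hg
    · obtain rfl : i = ⟨c, hc⟩ := Fin.ext hi
      exact hnzd g hg

end Infinite

/-! ### Extension of the base field -/

section BaseChange

variable {k K : Type u} [Field k] [Field K] [Algebra k K] {σ : Type}

/-- A `k`-linear functional on `K` applied to the coefficients is linear over `k[x]`. -/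
theorem exists_coeff_eq_apply (φ : K →ₗ[k] k) :
    ∃ Φ : MvPolynomial σ K → MvPolynomial σ k, (∀ y μ, coeff μ (Φ y) = φ (coeff μ y)) ∧
      (∀ y x, Φ (y * map (algebraMap k K) x) = Φ y * x) ∧
      ∀ {ι : Type} (s : Finset ι) (y : ι → MvPolynomial σ K),
        Φ (∑ i ∈ s, y i) = ∑ i ∈ s, Φ (y i) := by
  classical
  have hΦ : ∀ (y : MvPolynomial σ K) (μ : σ →₀ ℕ),
      coeff μ (∑ ν ∈ y.support, monomial ν (φ (coeff ν y))) = φ (coeff μ y) := by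
    intro y μ
    simp only [coeff_sum, coeff_monomial, Finset.sum_ite_eq', mem_support_iff]
    split_ifs with h
    · rfl
    · rw [not_not.1 h, map_zero]
  refine ⟨fun y => ∑ ν ∈ y.support, monomial ν (φ (coeff ν y)), hΦ, fun y x => ?_, fun s y => ?_⟩
  · ext μ
    rw [hΦ, coeff_mul, coeff_mul, map_sum]
    refine Finset.sum_congr rfl fun p _ => ?_
    rw [hΦ, coeff_map, mul_comm, ← Algebra.smul_def, map_smul, smul_eq_mul, mul_comm]
  · ext μ
    rw [hΦ, coeff_sum, coeff_sum, map_sum]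
    exact Finset.sum_congr rfl fun i _ => (hΦ _ _).symm

variable {r : ℕ} {f : Fin r → MvPolynomial σ k}

theorem apply_mem_span_of_mem_span_map {Φ : MvPolynomial σ K → MvPolynomial σ k}
    (hmul : ∀ y x, Φ (y * map (algebraMap k K) x) = Φ y * x)
    (hsum : ∀ {ι : Type} (s : Finset ι) (y : ι → MvPolynomial σ K),
      Φ (∑ i ∈ s, y i) = ∑ i ∈ s, Φ (y i)) (h0 : Φ 0 = 0) {c : Fin r} {g : MvPolynomial σ K}
    (hg : g ∈ Ideal.span ((fun i => map (algebraMap k K) (f i)) '' Set.Iio c)) :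
    Φ g ∈ Ideal.span (f '' Set.Iio c) := by
  obtain ⟨a, ha, rfl⟩ := (mem_span_image_iff _ c _).1 hg
  refine (mem_span_image_iff f c _).2 ⟨fun i => Φ (a i), fun i hi => by simp [ha i hi, h0], ?_⟩
  rw [hsum]
  exact Finset.sum_congr rfl fun i _ => hmul _ _

theorem map_mem_span {c : Fin r} {g : MvPolynomial σ k} (hg : g ∈ Ideal.span (f '' Set.Iio c)) :
    map (algebraMap k K) g ∈
      Ideal.span ((fun i => map (algebraMap k K) (f i)) '' Set.Iio c) := by
  have := Ideal.mem_map_of_mem (map (algebraMap k K)) hg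
  rwa [Ideal.map_span, Set.image_image] at this

/-- Cancellation in bounded degree is preserved by an extension of the base field: it can be
checked on the coordinates with respect to a basis. -/
theorem BoundedCancel.map {B : ℕ} (h : BoundedCancel B f) :
    BoundedCancel B fun i => MvPolynomial.map (algebraMap k K) (f i) := by
  classical
  intro c e g he hg hmem
  let b := Module.Basis.ofVectorSpace k K
  choose Φ hΦ hmul hsum using fun j => exists_coeff_eq_apply (σ := σ) (b.coord j)
  have hΦ0 : ∀ j, Φ j 0 = 0 := fun j => by
    ext μ
    rw [hΦ, coeff_zero, map_zero, coeff_zero]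
  have hdec : g = ∑ j ∈ g.support.biUnion fun μ => (b.repr (coeff μ g)).support,
      C (b j) * MvPolynomial.map (algebraMap k K) (Φ j g) := by
    ext μ
    simp only [coeff_sum, coeff_C_mul, coeff_map, hΦ]
    by_cases hμ : μ ∈ g.support
    · conv_lhs => rw [← b.linearCombination_repr (coeff μ g), Finsupp.linearCombination_apply]
      rw [Finsupp.sum_of_support_subset _ (Finset.subset_biUnion_of_mem
        (fun μ => (b.repr (coeff μ g)).support) hμ) _ (by simp)]
      refine Finset.sum_congr rfl fun j _ => ?_
      rw [Algebra.smul_def, mul_comm, Module.Basis.coord_apply]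
    · rw [notMem_support_iff.1 hμ]
      simp
  rw [hdec]
  refine sum_mem fun j _ => Ideal.mul_mem_left _ _ (map_mem_span (h c e _ he ?_ ?_))
  · intro μ hμ
    refine hg fun h0 => hμ ?_
    rw [hΦ, h0, map_zero]
  · rw [← hmul]
    exact apply_mem_span_of_mem_span_map (hmul j) (hsum j) (hΦ0 j) hmem

/-- Cancellation descends along an extension of the base field. -/
theorem mem_span_of_map {c : Fin r} {g : MvPolynomial σ k}
    (hg : map (algebraMap k K) g ∈
      Ideal.span ((fun i => map (algebraMap k K) (f i)) '' Set.Iio c)) :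
    g ∈ Ideal.span (f '' Set.Iio c) := by
  obtain ⟨φ, hφ⟩ := (LinearMap.toSpanSingleton k K 1).exists_leftInverse_of_injective
    (LinearMap.ker_eq_bot.2 fun a b h => by simpa using h)
  obtain ⟨Φ, hΦ, hmul, hsum⟩ := exists_coeff_eq_apply (σ := σ) φ
  have hg' := apply_mem_span_of_mem_span_map hmul hsum (by ext μ; simp [hΦ]) hg
  convert hg'
  ext μ
  rw [hΦ, coeff_map]
  have := LinearMap.congr_fun hφ (coeff μ g)
  simpa [Algebra.algebraMap_eq_smul_one] using this.symm

end BaseChange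

/-- Over any field, cancellation in sufficiently large bounded degree implies cancellation. -/
theorem mem_of_boundedCancel {k : Type u} [Field k] {n r : ℕ} {d : Fin r → ℕ}
    (hd : ∀ i, 0 < d i) {Δ B : ℕ} (hΔ : ∀ i, d i ≤ Δ) (hB : ∀ c < r, paramBound Δ c * Δ ≤ B)
    {f : Fin r → MvPolynomial (Fin n) k} (hf : ∀ i, (f i).IsHomogeneous (d i))
    (hcancel : BoundedCancel B f) (i : Fin r) (g : MvPolynomial (Fin n) k)
    (hg : g * f i ∈ Ideal.span (f '' Set.Iio i)) : g ∈ Ideal.span (f '' Set.Iio i) := by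
  -- the algebraic closure is infinite
  refine mem_span_of_map (K := AlgebraicClosure k) ?_
  refine (exists_parameters hd hΔ hB (fun i => (hf i).map _) hcancel.map r le_rfl).1 i i.2 _ ?_
  rw [← map_mul]
  exact map_mem_span hg

/-! ### Collective strength and regular sequences -/

/-- A sum of few products bounds the strength. -/
theorem strength_le_of_hasProductDecomposition {k R : Type*} [Field k] [CommRing R] [Algebra k R]
    {𝒜 : ℕ → Submodule k R} {f : R} {m : ℕ} (h : HasProductDecomposition 𝒜 f m) :
    strength 𝒜 f ≤ (((m : ℤ) - 1 : ℤ) : WithTop ℤ) := by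
  refine (WithTop.isGLB_sInf' ⟨((-1 : ℤ) : WithTop ℤ), ?_⟩).1 ⟨m, h, rfl⟩
  rintro _ ⟨m, -, rfl⟩
  exact WithTop.coe_le_coe.2 (by omega)

theorem neg_one_le_strength {k R : Type*} [Field k] [CommRing R] [Algebra k R]
    (𝒜 : ℕ → Submodule k R) (f : R) : ((-1 : ℤ) : WithTop ℤ) ≤ strength 𝒜 f := by
  have hb : ((-1 : ℤ) : WithTop ℤ) ∈ lowerBounds {s : WithTop ℤ | ∃ m : ℕ,
      HasProductDecomposition 𝒜 f m ∧ s = (((m : ℤ) - 1 : ℤ) : WithTop ℤ)} := by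
    rintro _ ⟨m, -, rfl⟩
    exact WithTop.coe_le_coe.2 (by omega)
  exact (WithTop.isGLB_sInf' ⟨_, hb⟩).2 hb

theorem collectiveStrength_le_strength {k R ι : Type*} [Field k] [CommRing R] [Algebra k R]
    [Fintype ι] {𝒜 : ℕ → Submodule k R} {f : ι → R} {c : ι → k} (hc : c ≠ 0)
    (h : SetLike.IsHomogeneousElem 𝒜 (∑ i, c i • f i)) :
    collectiveStrength 𝒜 f ≤ strength 𝒜 (∑ i, c i • f i) := by
  refine (WithTop.isGLB_sInf' ⟨((-1 : ℤ) : WithTop ℤ), ?_⟩).1 ⟨c, hc, h, rfl⟩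
  rintro _ ⟨c, -, -, rfl⟩
  exact neg_one_le_strength 𝒜 _

theorem IsSumOfProducts.hasProductDecomposition {k : Type u} [Field k] {σ : Type} {d N : ℕ}
    {x : MvPolynomial σ k} (h : IsSumOfProducts d N x) :
    ∃ m ≤ N, HasProductDecomposition (homogeneousSubmodule σ k) x m := by
  obtain ⟨κ, _, a, g, h, hκ, ha, hx⟩ := h
  let ε := (Fintype.equivFin κ).symm
  refine ⟨Fintype.card κ, hκ, g ∘ ε, h ∘ ε, fun i => ⟨a (ε i), (ha _).1, (ha _).2.2.1⟩,
    fun i => ⟨d - a (ε i), Nat.sub_pos_of_lt (ha _).2.1, (ha _).2.2.2⟩, ?_⟩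
  rw [hx]
  exact (ε.sum_comp fun i => g i * h i).symm

/-- A combination of at most `N` products would have strength at most `N - 1`. -/
theorem FormFamily.indep_of_le_collectiveStrength {k : Type u} [Field k] {n r D N : ℕ}
    {d : Fin r → ℕ} (hd : ∀ i, 0 < d i) (hD : ∀ i, d i ≤ D) {f : Fin r → MvPolynomial (Fin n) k}
    (hf : ∀ i, (f i).IsHomogeneous (d i))
    (h : ((N : ℤ) : WithTop ℤ) ≤ collectiveStrength (homogeneousSubmodule (Fin n) k) f) :
    (FormFamily.ofForms d hd hD f hf).Indep N := by
  intro e (c : Fin r → k) hc hsum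
  by_contra h0
  obtain ⟨m, hm, hdec⟩ := hsum.hasProductDecomposition
  have hhom : SetLike.IsHomogeneousElem (homogeneousSubmodule (Fin n) k) (∑ i, c i • f i) := by
    refine ⟨e, sum_mem fun i _ => ?_⟩
    by_cases hci : c i = 0
    · rw [hci, zero_smul]
      exact zero_mem _
    · exact Submodule.smul_mem _ _ (hc i hci ▸ hf i)
  have := WithTop.coe_le_coe.1 (h.trans ((collectiveStrength_le_strength h0 hhom).trans
    (strength_le_of_hasProductDecomposition hdec)))
  omega

theorem isRegular_ofFn_of_forall_mem {k : Type u} [Field k] {σ : Type} {r : ℕ} {d : Fin r → ℕ}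
    (hd : ∀ i, 0 < d i) {f : Fin r → MvPolynomial σ k} (hf : ∀ i, (f i).IsHomogeneous (d i))
    (h : ∀ i g, g * f i ∈ Ideal.span (f '' Set.Iio i) → g ∈ Ideal.span (f '' Set.Iio i)) :
    RingTheory.Sequence.IsRegular (MvPolynomial σ k) (List.ofFn f) := by
  refine ⟨⟨fun i hi => ?_⟩, fun htop => ?_⟩
  · rw [List.length_ofFn] at hi
    rw [isSMulRegular_quotient_iff_mem_of_smul_mem]
    have hspan : Ideal.ofList ((List.ofFn f).take i) = Ideal.span (f '' Set.Iio ⟨i, hi⟩) := by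
      refine congrArg Ideal.span (Set.ext fun y => ?_)
      simp only [Set.mem_ofPred_eq, List.mem_take_iff_getElem, List.getElem_ofFn, List.length_ofFn,
        Set.mem_image, Set.mem_Iio]
      constructor
      · rintro ⟨j, hj, rfl⟩
        exact ⟨⟨j, by omega⟩, Fin.mk_lt_mk.2 (by omega), rfl⟩
      · rintro ⟨j, hj, rfl⟩
        exact ⟨j, lt_min hj j.2, rfl⟩
    intro g hg
    rw [hspan, smul_eq_mul, Ideal.mul_top, List.getElem_ofFn] at *
    rw [smul_eq_mul, mul_comm] at hg
    exact h _ g hg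
  · rw [smul_eq_mul, Ideal.mul_top] at htop
    have h1 : Ideal.ofList (List.ofFn f) ≤ RingHom.ker (constantCoeff (σ := σ) (R := k)) := by
      refine Ideal.span_le.2 fun y hy => ?_
      obtain ⟨i, rfl⟩ := List.mem_ofFn.1 hy
      exact (hf i).coeff_eq_zero (by simpa using (hd i).ne)
    have h2 := h1 (htop ▸ Submodule.mem_top : (1 : MvPolynomial σ k) ∈ _)
    rw [RingHom.mem_ker, map_one] at h2
    exact one_ne_zero h2

theorem mainTheorem1 {r : ℕ} (d : Fin r → ℕ) (hd : ∀ i, 0 < d i) :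
    ∃ N : ℤ, ∀ (k : Type*) [Field k] [PerfectField k] (n : ℕ)
      (f : Fin r → MvPolynomial (Fin n) k),
      (∀ i, f i ∈ MvPolynomial.homogeneousSubmodule (Fin n) k (d i)) →
      (N : WithTop ℤ) ≤
        collectiveStrength (MvPolynomial.homogeneousSubmodule (Fin n) k) f →
      RingTheory.Sequence.IsRegular (MvPolynomial (Fin n) k) (List.ofFn f) := by
  have hΔ : ∀ i, d i ≤ ∑ j, d j := fun i =>
    Finset.single_le_sum (f := d) (fun _ _ => Nat.zero_le _) (Finset.mem_univ i)
  generalize ∑ j, d j = Δ at hΔ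
  have hB : ∀ c < r, paramBound Δ c * Δ ≤ ∑ c ∈ Finset.range r, paramBound Δ c * Δ :=
    fun c hc => Finset.single_le_sum (f := fun c => paramBound Δ c * Δ)
      (fun _ _ => Nat.zero_le _) (Finset.mem_range.2 hc)
  generalize ∑ c ∈ Finset.range r, paramBound Δ c * Δ = B at hB
  -- cancellation in degrees up to `B` is sufficient for cancellation in all degrees
  obtain ⟨N, hN⟩ := exists_boundedCancel d hd B (B + Δ) fun i => Nat.add_le_add_left (hΔ i) B
  refine ⟨N, fun k _ _ n f hf hs => isRegular_ofFn_of_forall_mem hd hf ?_⟩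
  exact mem_of_boundedCancel hd hΔ hB hf (hN k (Fin n) f hf
    (FormFamily.indep_of_le_collectiveStrength hd _ hf hs))
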